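/- Let $M\ge 0$ be an integer, $\alpha>0$, $\rho(1),\dots,\rho(M)>0$, and let $F_0$ be a probability measure on $\mathbb R$ with Lebesgue density $f_0$ and quantile function $F_0^{-1}$, where $F_0^{-1}(0)=-\infty$ and $F_0^{-1}(1)=\infty$. For $1\le m\le M$ and $1\le j\le 2^m$ put $B_{mj}=\left(F_0^{-1}\left(\frac{j-1}{2^m}\right),F_0^{-1}\left(\frac{j}{2^m}\right)\right]\cap\mathbb R$, and for $x\in\mathbb R$ let $j_m^{(x)}$ be the index $j$ with $x\in B_{mj}$. Let $Y_{m,2j-1}$ ($1\le m\le M$, $1\le j\le 2^{m-1}$) be independent random variables with $Y_{m,2j-1}\sim\mathrm{Beta}(\alpha\rho(m),\alpha\rho(m))$, and let $Y_{m,2j}=1-Y_{m,2j-1}$. Let $F\sim\mathcal{PT}_M(\alpha,\rho,F_0)$ be the finite Pólya tree with these branching probabilities, that is, the random probability measure which almost surely has the Lebesgue density $$f(x)=\Big(\prod_{m=1}^M Y_{m,j_m^{(x)}}\Big)\,2^M f_0(x).$$ Then, almost surely, the integral $\mathrm{KL}(f\|f_0)=\int_{\mathbb R}\log\left\{\frac{f(x)}{f_0(x)}\right\}f(x)\,dx$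 (with integrand $0$ where $f(x)=0$) converges absolutely and $$\mathrm{KL}(f\|f_0)=\sum_{m=1}^M\sum_{j=1}^{2^m}(\log Y_{mj})\prod_{k=1}^{m}Y_{m-k+1,\,j_{m-k+1}^{(m,j)}}+M\log 2,$$ where $j_m^{(m,j)}=j$ and $j_{k-1}^{(m,j)}=\lceil j_k^{(m,j)}/2\rceil$. The random variable $\mathrm{KL}(f\|f_0)$ is square integrable, with mean $$\mathrm E\{\mathrm{KL}(f\|f_0)\}=\sum_{m=1}^M\left\{\psi_0(\alpha\rho(m)+1)-\psi_0(2\alpha\rho(m)+1)+\log 2\right\}$$ and variance $\mathrm{Var}\{\mathrm{KL}(f\|f_0)\}=A+B$, where $\psi_0=\Gamma'/\Gamma$ and $\psi_1=\psi_0'$ are the digamma and trigamma functions, $$A=\sum_{m=1}^M\left[\left\{\prod_{k=1}^m\frac{\alpha\rho(k)+1}{2\alpha\rho(k)+1}\right\}\lambda_5(m)-\left(\tfrac12\right)^m\lambda_2^2(m)\right],$$ $$\begin{aligned}B=\sum_{m=1}^M\Bigg(&\frac{\alpha\rho(m)}{2\alpha\rho(m)+1}\left\{\prod_{k=1}^{m-1}\frac{\alpha\rho(k)+1}{2\alpha\rho(k)+1}\right\}\lambda_6(m)-\left(\tfrac12\right)^m\lambda_2^2(m)\\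 &+\sum_{j=1}^{m-1}\left[\frac{\alpha\rho(j)}{2\alpha\rho(j)+1}\left\{\prod_{k=1}^{j-1}\frac{\alpha\rho(k)+1}{2\alpha\rho(k)+1}\right\}\lambda_2^2(m)-\left(\tfrac12\right)^j\lambda_2^2(m)\right]\\ &+2\left\{\prod_{k=1}^{m-1}\frac{\alpha\rho(k)+1}{2\alpha\rho(k)+1}\right\}\sum_{j=m+1}^{M}\left\{\frac{\alpha\rho(m)+1}{2\alpha\rho(m)+1}\lambda_3(m)\lambda_2(j)+\frac{\alpha\rho(m)}{2\alpha\rho(m)+1}\lambda_4(m)\lambda_2(j)-\lambda_2(m)\lambda_2(j)\right\}\Bigg),\end{aligned}$$ and $$\begin{aligned} \lambda_2(m)&=\psi_0(\alpha\rho(m)+1)-\psi_0(2\alpha\rho(m)+1),\\ \lambda_3(m)&=\psi_0(\alpha\rho(m)+2)-\psi_0(2\alpha\rho(m)+2),\\ \lambda_4(m)&=\psi_0(\alpha\rho(m)+1)-\psi_0(2\alpha\rho(m)+2),\\ \lambda_5(m)&=\psi_1(\alpha\rho(m)+2)-\psi_1(2\alpha\rho(m)+2)+\left\{\psi_0(\alpha\rho(m)+2)-\psi_0(2\alpha\rho(m)+2)\right\}^2,\\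 \lambda_6(m)&=\left\{\psi_0(\alpha\rho(m)+1)-\psi_0(2\alpha\rho(m)+2)\right\}^2-\psi_1(2\alpha\rho(m)+2). \end{aligned}$$ -/

import Mathlib

open MeasureTheory ProbabilityTheory

noncomputable section

namespace PolyaKL

/-- The real digamma function `ψ₀ = Γ' / Γ`. -/
def digamma : ℝ → ℝ := logDeriv Real.Gamma

/-- The real trigamma function `ψ₁ = ψ₀'`. -/
def trigamma : ℝ → ℝ := deriv digamma

/-- `f` is a (nonnegative, measurable) Lebesgue density of `μ`. -/
structure IsDensity (f : ℝ → ℝ) (μ : Measure ℝ) : Prop where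
  measurable : Measurable f
  nonneg : ∀ x, 0 ≤ f x
  eq_withDensity : μ = volume.withDensity (fun x => ENNReal.ofReal (f x))

/-- The integrand `log (f / g) * f` of the Kullback-Leibler divergence. -/
def klIntegrand (f g : ℝ → ℝ) (x : ℝ) : ℝ := Real.log (f x / g x) * f x

/-- The Kullback-Leibler divergence `KL(f || g)` between two densities. -/
def kl (f g : ℝ → ℝ) : ℝ := ∫ x, klIntegrand f g x

open Classical in
/-- The quantile function `F₀⁻¹` of `F₀`, with `F₀⁻¹(0) = -∞` and `F₀⁻¹(1) = ∞`. -/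
def quantile (F₀ : Measure ℝ) (u : ℝ) : EReal :=
  if u ≤ 0 then ⊥ else if 1 ≤ u then ⊤ else ((sInf {x : ℝ | u ≤ cdf F₀ x} : ℝ) : EReal)

/-- The partition set `B_{mj} = (F₀⁻¹((j-1)/2^m), F₀⁻¹(j/2^m)]`, for `1 ≤ j ≤ 2^m`. -/
def cell (F₀ : Measure ℝ) (m j : ℕ) : Set ℝ :=
  {x : ℝ | quantile F₀ (((j : ℝ) - 1) / 2 ^ m) < (x : EReal) ∧
    (x : EReal) ≤ quantile F₀ ((j : ℝ) / 2 ^ m)}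

/-- The (unique) `j` in `{1, …, 2^m}` such that `x` lies in `B_{mj}`. -/
def cellIndex (F₀ : Measure ℝ) (m : ℕ) (x : ℝ) : ℕ :=
  sInf {j : ℕ | 1 ≤ j ∧ j ≤ 2 ^ m ∧ x ∈ cell F₀ m j}

/-- The index `j_l^{(m,j)}` of the ancestor at level `l ≤ m` of the set `B_{mj}`: one starts
with `j` at level `m`, and each step upwards replaces `i` by `⌈i / 2⌉ = (i + 1) / 2`. -/
def ancestor (m j l : ℕ) : ℕ := (fun i : ℕ => (i + 1) / 2)^[m - l] j

/-- The density `f(x) = ∏_{m=1}^M Y_{m, j_m^{(x)}} 2^M f₀(x)` of a finite Pólya tree with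
branching probabilities `y`. -/
def treeDensity (M : ℕ) (F₀ : Measure ℝ) (f₀ : ℝ → ℝ) (y : ℕ → ℕ → ℝ) (x : ℝ) : ℝ :=
  (∏ m ∈ Finset.Icc 1 M, y m (cellIndex F₀ m x)) * 2 ^ M * f₀ x

/-- `F ∼ PT_M(α, ρ, F₀)` with branching probabilities `Y m j` (`1 ≤ m ≤ M`, `1 ≤ j ≤ 2^m`),
where `f₀` is the density of `F₀`.
The pair `⟨m, i⟩ : Σ m : Fin M, Fin (2 ^ m)` stands for level `m + 1` and
for the siblings `2 i + 1` and `2 i + 2` at that level. -/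
structure IsFinitePolyaTree {Ω : Type*} [MeasurableSpace Ω] (P : Measure Ω) (M : ℕ) (α : ℝ)
    (ρ : ℕ → ℝ) (F₀ : Measure ℝ) (f₀ : ℝ → ℝ) (Y : ℕ → ℕ → Ω → ℝ) (F : Ω → Measure ℝ) :
    Prop where
  measurable_left : ∀ p : (Σ m : Fin M, Fin (2 ^ (m : ℕ))),
    Measurable (Y ((p.1 : ℕ) + 1) (2 * (p.2 : ℕ) + 1))
  indep : iIndepFun (fun (p : (Σ m : Fin M, Fin (2 ^ (m : ℕ)))) =>
    Y ((p.1 : ℕ) + 1) (2 * (p.2 : ℕ) + 1)) P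
  law : ∀ p : (Σ m : Fin M, Fin (2 ^ (m : ℕ))),
    P.map (Y ((p.1 : ℕ) + 1) (2 * (p.2 : ℕ) + 1)) =
      betaMeasure (α * ρ ((p.1 : ℕ) + 1)) (α * ρ ((p.1 : ℕ) + 1))
  right : ∀ (p : (Σ m : Fin M, Fin (2 ^ (m : ℕ)))) (ω : Ω),
    Y ((p.1 : ℕ) + 1) (2 * (p.2 : ℕ) + 2) ω = 1 - Y ((p.1 : ℕ) + 1) (2 * (p.2 : ℕ) + 1) ω
  measurable : Measurable F
  isProbabilityMeasure : ∀ ω, IsProbabilityMeasure (F ω)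
  density : ∀ᵐ ω ∂P, F ω = volume.withDensity
    (fun x => ENNReal.ofReal (treeDensity M F₀ f₀ (fun m j => Y m j ω) x))

/-- `∑_{m=1}^M ∑_{j=1}^{2^m} (log Y_{mj}) ∏_{k=1}^m Y_{m-k+1, j_{m-k+1}^{(m,j)}} + M log 2`. -/
def reverseKLSum (M : ℕ) (y : ℕ → ℕ → ℝ) : ℝ :=
  (∑ m ∈ Finset.Icc 1 M, ∑ j ∈ Finset.Icc 1 (2 ^ m),
    Real.log (y m j) * ∏ k ∈ Finset.Icc 1 m, y (m - k + 1) (ancestor m j (m - k + 1)))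
  + M * Real.log 2

section Constants

variable (α : ℝ) (ρ : ℕ → ℝ)

def lambda2 (m : ℕ) : ℝ := digamma (α * ρ m + 1) - digamma (2 * α * ρ m + 1)

def lambda3 (m : ℕ) : ℝ := digamma (α * ρ m + 2) - digamma (2 * α * ρ m + 2)

def lambda4 (m : ℕ) : ℝ := digamma (α * ρ m + 1) - digamma (2 * α * ρ m + 2)

def lambda5 (m : ℕ) : ℝ :=
  trigamma (α * ρ m + 2) - trigamma (2 * α * ρ m + 2)
    + (digamma (α * ρ m + 2) - digamma (2 * α * ρ m + 2)) ^ 2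

def lambda6 (m : ℕ) : ℝ :=
  (digamma (α * ρ m + 1) - digamma (2 * α * ρ m + 2)) ^ 2 - trigamma (2 * α * ρ m + 2)

/-- `∏_{k=1}^m (α ρ(k) + 1) / (2 α ρ(k) + 1)`. -/
def ratioProd (m : ℕ) : ℝ :=
  ∏ k ∈ Finset.Icc 1 m, (α * ρ k + 1) / (2 * α * ρ k + 1)

def varA (M : ℕ) : ℝ :=
  ∑ m ∈ Finset.Icc 1 M,
    (ratioProd α ρ m * lambda5 α ρ m - (1 / 2 : ℝ) ^ m * lambda2 α ρ m ^ 2)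

def varB (M : ℕ) : ℝ :=
  ∑ m ∈ Finset.Icc 1 M,
    ((α * ρ m / (2 * α * ρ m + 1)) * ratioProd α ρ (m - 1) * lambda6 α ρ m
        - (1 / 2 : ℝ) ^ m * lambda2 α ρ m ^ 2
      + ∑ j ∈ Finset.Icc 1 (m - 1),
          ((α * ρ j / (2 * α * ρ j + 1)) * ratioProd α ρ (j - 1) * lambda2 α ρ m ^ 2
            - (1 / 2 : ℝ) ^ j * lambda2 α ρ m ^ 2)
      + 2 * ratioProd α ρ (m - 1) * ∑ j ∈ Finset.Icc (m + 1) M,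
          (((α * ρ m + 1) / (2 * α * ρ m + 1)) * lambda3 α ρ m * lambda2 α ρ j
            + (α * ρ m / (2 * α * ρ m + 1)) * lambda4 α ρ m * lambda2 α ρ j
            - lambda2 α ρ m * lambda2 α ρ j))

end Constants

end PolyaKL

end

namespace PolyaKL

open Set Filter Topology

/-! ### The digamma and trigamma functions -/

/-! On the level-`M` cells the ratio `f / f₀` is constant, equal to `2 ^ M` times the path product
`p` of the cell (`treeDensity_eq`), and each cell has `F₀`-mass `2⁻ᴹ` (`measure_cell`). So the
divergence is `M log 2` minus the Shannon entropy of the vector `p` (`kl_treeDensity`). The chain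
rule for entropy (`sum_negMulLog_pathProd`) writes this entropy as the sum over nodes of the node's
mass times the binary entropy of the split below it. Pairing siblings turns the stated double sum
into the same expression (`reverseKLSum_eq`).

A split at level `m` has mean entropy `-λ₂(m)`, and the masses at each level sum to 1. Hence the
divergence is the constant `∑ (λ₂(m) + log 2)` minus a sum of centred increments, one per level. All
variables are almost surely bounded, which settles integrability.

The increments are martingale differences for the filtration by levels (`integral_mul_increment`),
so their variances add. Within a level, distinct splits are independent and centred, so only
diagonal terms remain. The second moment is then the expected sum of squared masses, `ratioProd`,
times the variance of one split entropy (`integral_increment_sq`).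

The Beta moments come from differentiating the Beta integral in its parameters. In `varA + varB` the
sums over `j > m` vanish and those over `j < m` telescope, leaving exactly this sum of variances
(`varA_add_varB`). -/

lemma contDiffAt_Gamma {x : ℝ} (hx : 0 < x) {n : WithTop ℕ∞} : ContDiffAt ℝ n Real.Gamma x := by
  -- Holomorphy on the open right half-plane gives every order of smoothness at once.
  have h : ContDiffAt ℂ n Complex.Gamma (x : ℂ) := by
    have ho : IsOpen {z : ℂ | 0 < z.re} := isOpen_lt continuous_const Complex.continuous_re
    have hd : DifferentiableOn ℂ Complex.Gamma {z : ℂ | 0 < z.re} := by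
      intro z hz
      refine (Complex.differentiableAt_Gamma z fun m hm => ?_).differentiableWithinAt
      have : (0 : ℝ) < z.re := hz
      rw [hm] at this
      simp at this
      linarith [(Nat.cast_nonneg m : (0 : ℝ) ≤ m)]
    exact (hd.analyticAt (ho.mem_nhds (by simpa using hx))).contDiffAt
  exact h.real_of_complex

lemma hasDerivAt_Gamma {x : ℝ} (hx : 0 < x) :
    HasDerivAt Real.Gamma (Real.Gamma x * digamma x) x := by
  have h := ((contDiffAt_Gamma hx (n := 1)).differentiableAt (by simp)).hasDerivAt
  have h0 := (Real.Gamma_pos_of_pos hx).ne'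
  have : Real.Gamma x * digamma x = deriv Real.Gamma x := by
    rw [digamma, logDeriv_apply]; field_simp
  rwa [this]

lemma hasDerivAt_digamma {x : ℝ} (hx : 0 < x) : HasDerivAt digamma (trigamma x) x := by
  have h2 : ContDiffAt ℝ 1 (deriv Real.Gamma) x :=
    (contDiffAt_Gamma hx (n := 2)).derivWithin (by norm_num [one_add_one_eq_two])
  exact ((h2.differentiableAt (by simp)).div
    ((contDiffAt_Gamma hx (n := 1)).differentiableAt (by simp))
    (Real.Gamma_pos_of_pos hx).ne').hasDerivAt

/-- Differentiate `Γ(y + 1) = y Γ(y)` and compare derivatives at `x`. -/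
lemma digamma_add_one {x : ℝ} (hx : 0 < x) : digamma (x + 1) = digamma x + 1 / x := by
  have h0 := (Real.Gamma_pos_of_pos hx).ne'
  have h1 : HasDerivAt (fun y => Real.Gamma (y + 1)) (Real.Gamma (x + 1) * digamma (x + 1)) x :=
    (hasDerivAt_Gamma (by linarith : 0 < x + 1)).comp_add_const x 1
  have h2 : HasDerivAt (fun y => y * Real.Gamma y)
      (1 * Real.Gamma x + x * (Real.Gamma x * digamma x)) x :=
    (hasDerivAt_id x).mul (hasDerivAt_Gamma hx)
  have h3 := h1.unique (h2.congr_of_eventuallyEq ((eventually_ne_nhds hx.ne').mono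
    fun y hy => Real.Gamma_add_one hy))
  rw [Real.Gamma_add_one hx.ne'] at h3
  field_simp at h3 ⊢
  linarith

lemma hasDerivAt_beta_left {u v : ℝ} (hu : 0 < u) (hv : 0 < v) :
    HasDerivAt (fun s => beta s v) (beta u v * (digamma u - digamma (u + v))) u := by
  have huv : 0 < u + v := by linarith
  have h0 := (Real.Gamma_pos_of_pos huv).ne'
  have h := ((hasDerivAt_Gamma hu).mul_const (Real.Gamma v)).div
    ((hasDerivAt_Gamma huv).comp_add_const u v) h0
  refine h.congr_deriv ?_
  rw [beta]
  field_simp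

lemma beta_comm (u v : ℝ) : beta u v = beta v u := by
  rw [beta, beta, mul_comm, add_comm]

lemma hasDerivAt_beta_right {u v : ℝ} (hu : 0 < u) (hv : 0 < v) :
    HasDerivAt (fun s => beta u s) (beta u v * (digamma v - digamma (u + v))) v := by
  have h := hasDerivAt_beta_left hv hu
  simp_rw [beta_comm _ u, add_comm v u] at h
  exact h

lemma beta_add_one_left {u v : ℝ} (hu : 0 < u) (hv : 0 < v) :
    beta (u + 1) v = u / (u + v) * beta u v := by
  have huv : 0 < u + v := by linarith
  have h0 := (Real.Gamma_pos_of_pos huv).ne'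
  rw [beta, beta, Real.Gamma_add_one hu.ne', add_right_comm, Real.Gamma_add_one huv.ne']
  field_simp

/-! ### Logarithmic moments of the beta distribution -/

/-- Differentiation of `s ↦ ∫ h g ^ s` under the integral sign, for `g` with values in `(0, 1)`. -/
lemma hasDerivAt_integral_rpow {X : Type*} [MeasurableSpace X] {μ : Measure X} {g h : X → ℝ}
    (hg : Measurable g) (hh : Measurable h) (hg01 : ∀ᵐ x ∂μ, g x ∈ Ioo (0 : ℝ) 1) {s₀ s : ℝ}
    (hs : s₀ < s) (hint : Integrable (fun x => h x * g x ^ s₀) μ) :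
    Integrable (fun x => h x * (Real.log (g x) * g x ^ s)) μ ∧
      HasDerivAt (fun t => ∫ x, h x * g x ^ t ∂μ) (∫ x, h x * (Real.log (g x) * g x ^ s) ∂μ) s := by
  -- The midpoint leaves room on both sides: the power `g ^ (m - s₀)` absorbs the logarithm, and `g
  -- ^ (t - m) ≤ 1` makes the bound uniform in `t > m`.
  set m := (s₀ + s) / 2 with hm
  have hε : 0 < m - s₀ := by rw [hm]; linarith
  refine hasDerivAt_integral_of_dominated_loc_of_deriv_le (s := Ioi m)
    (bound := fun x => |h x * g x ^ s₀| * (1 / (m - s₀)))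
    (F' := fun t x => h x * (Real.log (g x) * g x ^ t)) (Ioi_mem_nhds (by rw [hm]; linarith))
    (Eventually.of_forall fun t => by fun_prop) ?_ (by fun_prop) ?_ (hint.abs.mul_const _) ?_
  · refine hint.mono (by fun_prop) ?_
    filter_upwards [hg01] with x hx
    rw [norm_mul, norm_mul]
    refine mul_le_mul_of_nonneg_left ?_ (norm_nonneg _)
    rw [Real.norm_of_nonneg (Real.rpow_nonneg hx.1.le _),
      Real.norm_of_nonneg (Real.rpow_nonneg hx.1.le _)]
    exact Real.rpow_le_rpow_of_exponent_ge hx.1 hx.2.le hs.le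
  · filter_upwards [hg01] with x hx t ht
    have e : h x * (Real.log (g x) * g x ^ t)
        = h x * g x ^ s₀ * (Real.log (g x) * g x ^ (m - s₀)) * g x ^ (t - m) := by
      have : g x ^ t = g x ^ s₀ * g x ^ (m - s₀) * g x ^ (t - m) := by
        rw [← Real.rpow_add hx.1, ← Real.rpow_add hx.1]; congr 1; ring
      rw [this]; ring
    rw [e, Real.norm_eq_abs, abs_mul, abs_mul]
    have h1 := (Real.abs_log_mul_self_rpow_lt (g x) (m - s₀) hx.1 hx.2.le hε).le
    have h2 : |g x ^ (t - m)| ≤ 1 := by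
      rw [abs_of_nonneg (Real.rpow_nonneg hx.1.le _)]
      exact Real.rpow_le_one hx.1.le hx.2.le (by linarith [mem_Ioi.1 ht])
    calc _ ≤ |h x * g x ^ s₀| * (1 / (m - s₀)) * 1 := by gcongr
      _ = _ := mul_one _
  · filter_upwards [hg01] with x hx t _
    have := ((hasDerivAt_id t).const_rpow hx.1).const_mul (h x)
    refine this.congr_deriv ?_
    simp only [id]
    ring

lemma integrableOn_beta {u v : ℝ} (hu : 0 < u) (hv : 0 < v) :
    IntegrableOn (fun x : ℝ => x ^ (u - 1) * (1 - x) ^ (v - 1)) (Ioo 0 1) := by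
  have h := isProbabilityMeasureBeta hu hv
  have h1 : Integrable (betaPDFReal u v) := by
    refine ⟨by fun_prop, ?_⟩
    rw [hasFiniteIntegral_iff_norm]
    have : ∀ x, ENNReal.ofReal ‖betaPDFReal u v x‖ = betaPDF u v x := by
      intro x
      rw [betaPDF, Real.norm_of_nonneg]
      by_cases hx : 0 < x ∧ x < 1
      · exact (betaPDFReal_pos hx.1 hx.2 hu hv).le
      · simp [betaPDFReal, hx]
    simp_rw [this]
    rw [lintegral_betaPDF_eq_one hu hv]
    simp
  refine ((h1.const_mul (beta u v)).integrableOn (s := Ioo 0 1)).congr_fun (fun x hx => ?_)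
    measurableSet_Ioo
  have := (beta_pos hu hv).ne'
  simp only [betaPDFReal, if_pos (show 0 < x ∧ x < 1 from hx)]
  field_simp

lemma integral_betaMeasure {u v : ℝ} (hu : 0 < u) (hv : 0 < v) (g : ℝ → ℝ) :
    ∫ x, g x ∂(betaMeasure u v)
      = (∫ x in Ioo (0 : ℝ) 1, x ^ (u - 1) * (1 - x) ^ (v - 1) * g x) / beta u v := by
  rw [betaMeasure, integral_withDensity_eq_integral_toReal_smul
    (f := betaPDF u v) (by unfold betaPDF; fun_prop)
    (Eventually.of_forall fun x => by simp [betaPDF])]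
  rw [← integral_indicator measurableSet_Ioo, ← integral_div]
  refine integral_congr_ae (Eventually.of_forall fun x => ?_)
  have hb := (beta_pos hu hv).ne'
  by_cases hx : x ∈ Ioo (0 : ℝ) 1
  · simp only [indicator_of_mem hx, betaPDF, smul_eq_mul,
      ENNReal.toReal_ofReal (betaPDFReal_pos hx.1 hx.2 hu hv).le]
    simp only [betaPDFReal, if_pos (show 0 < x ∧ x < 1 from hx)]
    field_simp
  · simp [indicator_of_notMem hx, betaPDF, betaPDFReal, if_neg (show ¬ (0 < x ∧ x < 1) from hx)]

lemma betaMeasure_compl_Ioo (u v : ℝ) : betaMeasure u v (Ioo 0 1)ᶜ = 0 := by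
  rw [betaMeasure, withDensity_apply _ measurableSet_Ioo.compl]
  refine setLIntegral_eq_zero measurableSet_Ioo.compl fun x hx => ?_
  simp [betaPDF, betaPDFReal, if_neg (show ¬ (0 < x ∧ x < 1) from hx)]

lemma integral_beta {u v : ℝ} (hu : 0 < u) (hv : 0 < v) :
    ∫ x in Ioo (0 : ℝ) 1, x ^ (u - 1) * (1 - x) ^ (v - 1) = beta u v := by
  have h := isProbabilityMeasureBeta hu hv
  have h1 := integral_betaMeasure hu hv (fun _ => 1)
  have hb := (beta_pos hu hv).ne'
  simp only [integral_const, probReal_univ, smul_eq_mul, mul_one] at h1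
  field_simp at h1
  exact h1.symm

lemma ae_mem_Ioo : ∀ᵐ x ∂(volume.restrict (Ioo (0 : ℝ) 1)), x ∈ Ioo (0 : ℝ) 1 :=
  ae_restrict_mem measurableSet_Ioo

/-- Differentiating the Beta integral in `u` brings down `log x`. -/
lemma integral_beta_log {u v : ℝ} (hu : 0 < u) (hv : 0 < v) :
    IntegrableOn (fun x : ℝ => x ^ (u - 1) * (1 - x) ^ (v - 1) * Real.log x) (Ioo 0 1) ∧
    ∫ x in Ioo (0 : ℝ) 1, x ^ (u - 1) * (1 - x) ^ (v - 1) * Real.log x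
      = beta u v * (digamma u - digamma (u + v)) := by
  have h := hasDerivAt_integral_rpow (μ := volume.restrict (Ioo (0 : ℝ) 1)) (g := fun x => x)
    (h := fun x => (1 - x) ^ (v - 1)) (by fun_prop) (by fun_prop) ae_mem_Ioo
    -- Any exponent in `(-1, u - 1)` would do; halving `u` keeps the parameter positive.
    (s₀ := u / 2 - 1) (s := u - 1) (by linarith)
    ((integrableOn_beta (half_pos hu) hv).congr (Eventually.of_forall fun x => mul_comm _ _))
  have e : (fun x : ℝ => (1 - x) ^ (v - 1) * (Real.log x * x ^ (u - 1)))
    = fun x => x ^ (u - 1) * (1 - x) ^ (v - 1) * Real.log x := by ext x; ring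
  rw [e] at h
  refine ⟨h.1, h.2.unique ?_⟩
  have h3 : HasDerivAt (fun t => beta (t + 1) v) (beta u v * (digamma u - digamma (u + v)))
      (u - 1) := by
    have := (show HasDerivAt (fun s => beta s v) (beta u v * (digamma u - digamma (u + v)))
      (u - 1 + 1) by simpa using hasDerivAt_beta_left hu hv)
    exact this.comp_add_const (u - 1) 1
  refine h3.congr_of_eventuallyEq ?_
  filter_upwards [Ioi_mem_nhds (show -1 < u - 1 by linarith)] with t ht
  rw [← integral_beta (by linarith [mem_Ioi.1 ht]) hv]
  simp [mul_comm]

/-- A second derivative in `u`, applied to the first logarithmic moment. -/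
lemma integral_beta_log_sq {u v : ℝ} (hu : 0 < u) (hv : 0 < v) :
    IntegrableOn (fun x : ℝ => x ^ (u - 1) * (1 - x) ^ (v - 1) * Real.log x ^ 2) (Ioo 0 1) ∧
    ∫ x in Ioo (0 : ℝ) 1, x ^ (u - 1) * (1 - x) ^ (v - 1) * Real.log x ^ 2
      = beta u v * ((digamma u - digamma (u + v)) ^ 2 + (trigamma u - trigamma (u + v))) := by
  have h := hasDerivAt_integral_rpow (μ := volume.restrict (Ioo (0 : ℝ) 1)) (g := fun x => x)
    (h := fun x => (1 - x) ^ (v - 1) * Real.log x) (by fun_prop)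
    (by fun_prop) ae_mem_Ioo
    (s₀ := u / 2 - 1) (s := u - 1) (by linarith)
    ((integral_beta_log (half_pos hu) hv).1.congr (Eventually.of_forall fun x => by ring))
  have e : (fun x : ℝ => (1 - x) ^ (v - 1) * Real.log x * (Real.log x * x ^ (u - 1)))
    = fun x => x ^ (u - 1) * (1 - x) ^ (v - 1) * Real.log x ^ 2 := by ext x; ring
  rw [e] at h
  refine ⟨h.1, h.2.unique ?_⟩
  have huv : 0 < u + v := by linarith
  have h3 : HasDerivAt (fun t => beta t v * (digamma t - digamma (t + v)))
      (beta u v * ((digamma u - digamma (u + v)) ^ 2 + (trigamma u - trigamma (u + v)))) u := by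
    refine ((hasDerivAt_beta_left hu hv).mul ((hasDerivAt_digamma hu).sub
      ((hasDerivAt_digamma huv).comp_add_const u v))).congr_deriv ?_
    simp only [Pi.sub_apply]
    ring
  have h4 := (show HasDerivAt _ _ (u - 1 + 1) by simpa using h3).comp_add_const (u - 1) 1
  refine h4.congr_of_eventuallyEq ?_
  filter_upwards [Ioi_mem_nhds (show -1 < u - 1 by linarith)] with t ht
  rw [← (integral_beta_log (by linarith [mem_Ioi.1 ht]) hv).2]
  refine integral_congr_ae (Eventually.of_forall fun x => ?_)
  simp only [add_sub_cancel_right]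
  ring

/-- The mixed derivative: the first moment is differentiated in `v`, so only the `digamma (u + v)`
term contributes a trigamma. -/
lemma integral_beta_log_mul_log {u v : ℝ} (hu : 0 < u) (hv : 0 < v) :
    IntegrableOn (fun x : ℝ => x ^ (u - 1) * (1 - x) ^ (v - 1) * (Real.log x * Real.log (1 - x)))
      (Ioo 0 1) ∧
    ∫ x in Ioo (0 : ℝ) 1, x ^ (u - 1) * (1 - x) ^ (v - 1) * (Real.log x * Real.log (1 - x))
      = beta u v * ((digamma u - digamma (u + v)) * (digamma v - digamma (u + v))
          - trigamma (u + v)) := by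
  have h := hasDerivAt_integral_rpow (μ := volume.restrict (Ioo (0 : ℝ) 1)) (g := fun x => 1 - x)
    (h := fun x => x ^ (u - 1) * Real.log x) (by fun_prop) (by fun_prop)
    (ae_mem_Ioo.mono fun x hx => ⟨by linarith [hx.2], by linarith [hx.1]⟩)
    (s₀ := v / 2 - 1) (s := v - 1) (by linarith)
    ((integral_beta_log hu (half_pos hv)).1.congr (Eventually.of_forall fun x => by ring))
  have e : (fun x : ℝ => x ^ (u - 1) * Real.log x * (Real.log (1 - x) * (1 - x) ^ (v - 1)))
    = fun x => x ^ (u - 1) * (1 - x) ^ (v - 1) * (Real.log x * Real.log (1 - x)) := by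
    ext x; ring
  rw [e] at h
  refine ⟨h.1, h.2.unique ?_⟩
  have huv : 0 < u + v := by linarith
  have h3 : HasDerivAt (fun t => beta u t * (digamma u - digamma (u + t)))
      (beta u v * ((digamma u - digamma (u + v)) * (digamma v - digamma (u + v))
          - trigamma (u + v))) v := by
    refine ((hasDerivAt_beta_right hu hv).mul
      (((hasDerivAt_digamma huv).comp_const_add u v).const_sub (digamma u))).congr_deriv ?_
    ring
  have h4 := (show HasDerivAt _ _ (v - 1 + 1) by simpa using h3).comp_add_const (v - 1) 1
  refine h4.congr_of_eventuallyEq ?_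
  filter_upwards [Ioi_mem_nhds (show -1 < v - 1 by linarith)] with t ht
  rw [← (integral_beta_log hu (by linarith [mem_Ioi.1 ht])).2]
  refine integral_congr_ae (Eventually.of_forall fun x => ?_)
  simp only [add_sub_cancel_right]
  ring

lemma integrable_betaMeasure_of_continuous {u v : ℝ} (hu : 0 < u) (hv : 0 < v) {g : ℝ → ℝ}
    (hg : Continuous g) : Integrable g (betaMeasure u v) := by
  have h := isProbabilityMeasureBeta hu hv
  obtain ⟨C, hC⟩ := isCompact_Icc.exists_bound_of_continuousOn (s := Icc (0 : ℝ) 1) hg.continuousOn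
  refine Integrable.of_bound hg.aestronglyMeasurable C ?_
  have := betaMeasure_compl_Ioo u v
  filter_upwards [show ∀ᵐ x ∂(betaMeasure u v), x ∈ Ioo (0 : ℝ) 1 from this] with x hx
  exact hC x (Ioo_subset_Icc_self hx)

lemma integral_betaMeasure_one_sub {a : ℝ} (ha : 0 < a) (g : ℝ → ℝ) :
    ∫ x, g (1 - x) ∂(betaMeasure a a) = ∫ x, g x ∂(betaMeasure a a) := by
  rw [integral_betaMeasure ha ha, integral_betaMeasure ha ha]
  congr 1
  rw [← integral_Ioc_eq_integral_Ioo, ← integral_Ioc_eq_integral_Ioo,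
    ← intervalIntegral.integral_of_le zero_le_one, ← intervalIntegral.integral_of_le zero_le_one]
  have := intervalIntegral.integral_comp_sub_left (a := 0) (b := 1)
    (fun x : ℝ => x ^ (a - 1) * (1 - x) ^ (a - 1) * g x) 1
  simp only [sub_self, sub_zero] at this
  rw [← this]
  refine intervalIntegral.integral_congr fun x _ => ?_
  simp only [sub_sub_cancel]
  ring

/-- The factor `x` raises the first Beta parameter by one, and `beta_add_one_left` supplies the
normalising ratio. The next moments use the same device. -/
lemma integral_betaMeasure_mul_log {a : ℝ} (ha : 0 < a) :
    ∫ x, x * Real.log x ∂(betaMeasure a a)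
      = 1 / 2 * (digamma (a + 1) - digamma (2 * a + 1)) := by
  have hb := (beta_pos ha ha).ne'
  rw [integral_betaMeasure ha ha, show ∫ x in Ioo (0 : ℝ) 1,
      x ^ (a - 1) * (1 - x) ^ (a - 1) * (x * Real.log x) = ∫ x in Ioo (0 : ℝ) 1,
      x ^ (a + 1 - 1) * (1 - x) ^ (a - 1) * Real.log x from ?_,
    (integral_beta_log (by linarith) ha).2, beta_add_one_left ha ha,
    show a + 1 + a = 2 * a + 1 by ring]
  · field_simp
    ring
  · refine setIntegral_congr_fun measurableSet_Ioo fun x hx => ?_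
    simp only [show a + 1 - 1 = (a - 1) + 1 by ring, Real.rpow_add_one hx.1.ne']
    ring

lemma integral_betaMeasure_sq {a : ℝ} (ha : 0 < a) :
    ∫ x, x ^ 2 ∂(betaMeasure a a) = 1 / 2 * ((a + 1) / (2 * a + 1)) := by
  have hb := (beta_pos ha ha).ne'
  rw [integral_betaMeasure ha ha, show ∫ x in Ioo (0 : ℝ) 1,
      x ^ (a - 1) * (1 - x) ^ (a - 1) * x ^ 2 = ∫ x in Ioo (0 : ℝ) 1,
      x ^ (a + 1 + 1 - 1) * (1 - x) ^ (a - 1) from ?_,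
    integral_beta (by linarith) ha, beta_add_one_left (by linarith) ha, beta_add_one_left ha ha,
    show a + 1 + a = 2 * a + 1 by ring]
  · field_simp
    ring
  · refine setIntegral_congr_fun measurableSet_Ioo fun x hx => ?_
    simp only [show a + 1 + 1 - 1 = (a - 1) + 1 + 1 by ring, Real.rpow_add_one hx.1.ne']
    ring

lemma integral_betaMeasure_mul_log_sq {a : ℝ} (ha : 0 < a) :
    ∫ x, (x * Real.log x) ^ 2 ∂(betaMeasure a a)
      = 1 / 2 * ((a + 1) / (2 * a + 1)) * (trigamma (a + 2) - trigamma (2 * a + 2)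
        + (digamma (a + 2) - digamma (2 * a + 2)) ^ 2) := by
  have hb := (beta_pos ha ha).ne'
  rw [integral_betaMeasure ha ha, show ∫ x in Ioo (0 : ℝ) 1,
      x ^ (a - 1) * (1 - x) ^ (a - 1) * (x * Real.log x) ^ 2 = ∫ x in Ioo (0 : ℝ) 1,
      x ^ (a + 1 + 1 - 1) * (1 - x) ^ (a - 1) * Real.log x ^ 2 from ?_,
    (integral_beta_log_sq (by linarith) ha).2, beta_add_one_left (by linarith) ha,
    beta_add_one_left ha ha, show a + 1 + a = 2 * a + 1 by ring,
    show a + 1 + 1 + a = 2 * a + 2 by ring, show a + 1 + 1 = a + 2 by ring]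
  · field_simp
    ring
  · refine setIntegral_congr_fun measurableSet_Ioo fun x hx => ?_
    simp only [show a + 1 + 1 - 1 = (a - 1) + 1 + 1 by ring, Real.rpow_add_one hx.1.ne']
    ring

lemma integral_betaMeasure_mul_log_mul_mul_log {a : ℝ} (ha : 0 < a) :
    ∫ x, (x * Real.log x) * ((1 - x) * Real.log (1 - x)) ∂(betaMeasure a a)
      = 1 / 2 * (a / (2 * a + 1)) * ((digamma (a + 1) - digamma (2 * a + 2)) ^ 2
        - trigamma (2 * a + 2)) := by
  have hb := (beta_pos ha ha).ne'
  rw [integral_betaMeasure ha ha, show ∫ x in Ioo (0 : ℝ) 1,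
      x ^ (a - 1) * (1 - x) ^ (a - 1) * ((x * Real.log x) * ((1 - x) * Real.log (1 - x)))
      = ∫ x in Ioo (0 : ℝ) 1,
      x ^ (a + 1 - 1) * (1 - x) ^ (a + 1 - 1) * (Real.log x * Real.log (1 - x)) from ?_,
    (integral_beta_log_mul_log (by linarith) (by linarith)).2, beta_add_one_left ha (by linarith),
    beta_comm a (a + 1), beta_add_one_left ha ha,
    show a + 1 + (a + 1) = 2 * a + 2 by ring, show a + (a + 1) = 2 * a + 1 by ring]
  · field_simp
    ring
  · refine setIntegral_congr_fun measurableSet_Ioo fun x hx => ?_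
    have h1 : (1 - x) ≠ 0 := by linarith [hx.2]
    simp only [show a + 1 - 1 = (a - 1) + 1 by ring, Real.rpow_add_one hx.1.ne',
      Real.rpow_add_one h1]
    ring

lemma binEntropy_eq_neg (x : ℝ) :
    Real.binEntropy x = -(x * Real.log x + (1 - x) * Real.log (1 - x)) := by
  rw [Real.binEntropy_eq_negMulLog_add_negMulLog_one_sub, Real.negMulLog, Real.negMulLog]
  ring

lemma integral_betaMeasure_binEntropy {a : ℝ} (ha : 0 < a) :
    ∫ x, Real.binEntropy x ∂(betaMeasure a a) = -(digamma (a + 1) - digamma (2 * a + 1)) := by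
  have hc : Continuous fun x : ℝ => x * Real.log x := Real.continuous_mul_log
  have hc' : Continuous fun x : ℝ => (1 - x) * Real.log (1 - x) := hc.comp (by fun_prop)
  simp_rw [binEntropy_eq_neg]
  rw [integral_neg, integral_add (integrable_betaMeasure_of_continuous ha ha hc)
    (integrable_betaMeasure_of_continuous ha ha hc'),
    integral_betaMeasure_one_sub ha (fun x => x * Real.log x), integral_betaMeasure_mul_log ha]
  ring

/-- Expanding the square gives two squares, equal in mean by the symmetry `x ↦ 1 - x`, and a cross
term; these are the sources of `λ₅` and `λ₆`. -/
lemma integral_betaMeasure_binEntropy_sq {a : ℝ} (ha : 0 < a) :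
    ∫ x, Real.binEntropy x ^ 2 ∂(betaMeasure a a)
      = (a + 1) / (2 * a + 1) * (trigamma (a + 2) - trigamma (2 * a + 2)
          + (digamma (a + 2) - digamma (2 * a + 2)) ^ 2)
        + a / (2 * a + 1) * ((digamma (a + 1) - digamma (2 * a + 2)) ^ 2
          - trigamma (2 * a + 2)) := by
  have hc : Continuous fun x : ℝ => x * Real.log x := Real.continuous_mul_log
  have hc' : Continuous fun x : ℝ => (1 - x) * Real.log (1 - x) := hc.comp (by fun_prop)
  have i1 : Integrable (fun x : ℝ => (x * Real.log x) ^ 2) (betaMeasure a a) :=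
    integrable_betaMeasure_of_continuous ha ha (hc.pow 2)
  have i2 : Integrable (fun x : ℝ => ((1 - x) * Real.log (1 - x)) ^ 2) (betaMeasure a a) :=
    integrable_betaMeasure_of_continuous ha ha (hc'.pow 2)
  have i3 : Integrable (fun x : ℝ => 2 * ((x * Real.log x) * ((1 - x) * Real.log (1 - x))))
      (betaMeasure a a) :=
    (integrable_betaMeasure_of_continuous ha ha (hc.mul hc')).const_mul 2
  have e : ∀ x : ℝ, Real.binEntropy x ^ 2 = (x * Real.log x) ^ 2
      + ((1 - x) * Real.log (1 - x)) ^ 2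
      + 2 * ((x * Real.log x) * ((1 - x) * Real.log (1 - x))) := by
    intro x
    rw [binEntropy_eq_neg]
    ring
  simp_rw [e]
  rw [integral_add (by exact i1.add i2) i3, integral_add i1 i2, integral_const_mul,
    integral_betaMeasure_one_sub ha (fun x => (x * Real.log x) ^ 2),
    integral_betaMeasure_mul_log_sq ha, integral_betaMeasure_mul_log_mul_mul_log ha]
  ring

/-- This is the factor by which one split shrinks the expected sum of squared masses, hence the
factors of `ratioProd`. -/
lemma integral_betaMeasure_sq_add_sq {a : ℝ} (ha : 0 < a) :
    ∫ x, (x ^ 2 + (1 - x) ^ 2) ∂(betaMeasure a a) = (a + 1) / (2 * a + 1) := by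
  rw [integral_add (integrable_betaMeasure_of_continuous ha ha (by fun_prop))
    (integrable_betaMeasure_of_continuous ha ha (by fun_prop)),
    integral_betaMeasure_one_sub ha (fun x => x ^ 2), integral_betaMeasure_sq ha]
  ring

/-! ### Path products in the binary tree -/

/-- The product of the branching probabilities on the path from the root to the node `i + 1` at
level `m`. -/
noncomputable def pathProd (y : ℕ → ℕ → ℝ) (m i : ℕ) : ℝ :=
  ∏ l ∈ Finset.Icc 1 m, y l (ancestor m (i + 1) l)

/-- The siblings below each node at the levels `< M` have complementary probabilities. -/
def IsBranching (M : ℕ) (y : ℕ → ℕ → ℝ) : Prop :=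
  ∀ m < M, ∀ i < 2 ^ m, y (m + 1) (2 * i + 2) = 1 - y (m + 1) (2 * i + 1)

lemma ancestor_self (m j : ℕ) : ancestor m j m = j := by simp [ancestor]

lemma ancestor_succ {m l : ℕ} (h : l ≤ m) (j : ℕ) :
    ancestor (m + 1) j l = ancestor m ((j + 1) / 2) l := by
  rw [ancestor, ancestor, Nat.succ_sub h, Function.iterate_succ_apply]

lemma pathProd_zero (y : ℕ → ℕ → ℝ) (i : ℕ) : pathProd y 0 i = 1 := by simp [pathProd]

lemma pathProd_succ (y : ℕ → ℕ → ℝ) (m i : ℕ) :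
    pathProd y (m + 1) i = pathProd y m (i / 2) * y (m + 1) (i + 1) := by
  rw [pathProd, Finset.prod_Icc_succ_top (by omega), ancestor_self, pathProd]
  congr 1
  refine Finset.prod_congr rfl fun l hl => ?_
  rw [ancestor_succ (Finset.mem_Icc.1 hl).2]
  congr 2
  omega

lemma pathProd_succ_left (y : ℕ → ℕ → ℝ) (m i : ℕ) :
    pathProd y (m + 1) (2 * i) = pathProd y m i * y (m + 1) (2 * i + 1) := by
  rw [pathProd_succ]
  congr 2
  omega

lemma pathProd_succ_right (y : ℕ → ℕ → ℝ) (m i : ℕ) :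
    pathProd y (m + 1) (2 * i + 1) = pathProd y m i * y (m + 1) (2 * i + 2) := by
  rw [pathProd_succ]
  congr 2
  omega

lemma sum_range_two_mul (n : ℕ) (g : ℕ → ℝ) :
    ∑ j ∈ Finset.range (2 * n), g j = ∑ i ∈ Finset.range n, (g (2 * i) + g (2 * i + 1)) := by
  induction n with
  | zero => simp
  | succ n ih => rw [Finset.sum_range_succ, ← ih, show 2 * (n + 1) = 2 * n + 1 + 1 by ring,
      Finset.sum_range_succ, Finset.sum_range_succ, add_assoc]

lemma sum_Icc_one_eq_sum_range (n : ℕ) (g : ℕ → ℝ) :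
    ∑ j ∈ Finset.Icc 1 n, g j = ∑ i ∈ Finset.range n, g (i + 1) := by
  rw [Finset.range_eq_Ico, Finset.sum_Ico_add' g 0 n 1]
  rfl

lemma IsBranching.mono {M M' : ℕ} {y : ℕ → ℕ → ℝ} (h : IsBranching M' y) (hM : M ≤ M') :
    IsBranching M y := fun m hm i hi => h m (by omega) i hi

lemma sum_pathProd {M : ℕ} {y : ℕ → ℕ → ℝ} (h : IsBranching M y) :
    ∑ i ∈ Finset.range (2 ^ M), pathProd y M i = 1 := by
  induction M with
  | zero => simp [pathProd_zero]
  | succ m ih =>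
    rw [pow_succ', sum_range_two_mul, ← ih (h.mono (by omega))]
    refine Finset.sum_congr rfl fun i hi => ?_
    rw [pathProd_succ_left, pathProd_succ_right, h m (by omega) i (Finset.mem_range.1 hi)]
    ring

/-- Chain rule for entropy: splitting a node of mass `p` adds `p` times the binary entropy of the
split. `Real.negMulLog_mul` holds for all reals, so no positivity is needed. -/
lemma sum_negMulLog_pathProd {M : ℕ} {y : ℕ → ℕ → ℝ} (h : IsBranching M y) :
    ∑ i ∈ Finset.range (2 ^ M), Real.negMulLog (pathProd y M i)
      = ∑ m ∈ Finset.range M, ∑ i ∈ Finset.range (2 ^ m),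
        pathProd y m i * Real.binEntropy (y (m + 1) (2 * i + 1)) := by
  induction M with
  | zero => simp [pathProd_zero]
  | succ m ih =>
    rw [Finset.sum_range_succ, ← ih (h.mono (by omega)), pow_succ', sum_range_two_mul,
      ← Finset.sum_add_distrib]
    refine Finset.sum_congr rfl fun i hi => ?_
    rw [pathProd_succ_left, pathProd_succ_right, h m (by omega) i (Finset.mem_range.1 hi),
      Real.negMulLog_mul, Real.negMulLog_mul, Real.binEntropy_eq_negMulLog_add_negMulLog_one_sub]
    ring

lemma reverseKLSum_eq {M : ℕ} {y : ℕ → ℕ → ℝ} (h : IsBranching M y) :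
    reverseKLSum M y = -(∑ m ∈ Finset.range M, ∑ i ∈ Finset.range (2 ^ m),
        pathProd y m i * Real.binEntropy (y (m + 1) (2 * i + 1))) + M * Real.log 2 := by
  rw [reverseKLSum, sum_Icc_one_eq_sum_range, ← Finset.sum_neg_distrib]
  congr 1
  refine Finset.sum_congr rfl fun m hm => ?_
  rw [sum_Icc_one_eq_sum_range, pow_succ', sum_range_two_mul, ← Finset.sum_neg_distrib]
  have e : ∀ i, ∏ k ∈ Finset.Icc 1 (m + 1),
      y (m + 1 - k + 1) (ancestor (m + 1) (i + 1) (m + 1 - k + 1)) = pathProd y (m + 1) i := by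
    intro i
    rw [pathProd]
    -- The stated product climbs from the node to the root; the involution `k ↦ m + 2 - k` reverses
    -- it.
    refine Finset.prod_nbij' (fun k => m + 1 - k + 1) (fun k => m + 1 - k + 1) ?_ ?_ ?_ ?_ ?_
    · intro k hk; simp only [Finset.mem_Icc] at hk ⊢; omega
    · intro k hk; simp only [Finset.mem_Icc] at hk ⊢; omega
    · intro k hk; simp only [Finset.mem_Icc] at hk ⊢; omega
    · intro k hk; simp only [Finset.mem_Icc] at hk ⊢; omega
    · intro k hk; rfl
  refine Finset.sum_congr rfl fun i hi => ?_
  rw [e, e, pathProd_succ_left, pathProd_succ_right,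
    show 2 * i + 1 + 1 = 2 * i + 2 by ring,
    h m (Finset.mem_range.1 hm) i (Finset.mem_range.1 hi), binEntropy_eq_neg]
  ring

lemma pathProd_nonneg {M : ℕ} {y : ℕ → ℕ → ℝ}
    (h0 : ∀ m < M, ∀ j < 2 ^ (m + 1), 0 ≤ y (m + 1) (j + 1)) :
    ∀ i < 2 ^ M, 0 ≤ pathProd y M i := by
  induction M with
  | zero => intro i _; simp [pathProd_zero]
  | succ m ih =>
    intro i hi
    rw [pathProd_succ]
    refine mul_nonneg (ih (fun l hl => h0 l (by omega)) _ ?_) (h0 m (by omega) i hi)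
    rw [pow_succ] at hi
    omega

/-! ### The quantile partitions -/

section Cells

variable (F₀ : Measure ℝ)

lemma exists_le_cdf {u : ℝ} (hu : u < 1) : {x : ℝ | u ≤ cdf F₀ x}.Nonempty :=
  (((tendsto_cdf_atTop F₀).eventually (lt_mem_nhds hu)).exists).imp fun _ hx => le_of_lt hx

lemma bddBelow_le_cdf {u : ℝ} (hu : 0 < u) : BddBelow {x : ℝ | u ≤ cdf F₀ x} := by
  obtain ⟨b, hb⟩ := ((tendsto_cdf_atBot F₀).eventually (gt_mem_nhds hu)).exists
  refine ⟨b, fun x hx => ?_⟩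
  by_contra hxb
  have := monotone_cdf F₀ (not_le.1 hxb).le
  have hx : u ≤ cdf F₀ x := hx
  linarith

lemma quantile_of_nonpos {u : ℝ} (hu : u ≤ 0) : quantile F₀ u = ⊥ := by simp [quantile, hu]

lemma quantile_of_one_le {u : ℝ} (hu : 1 ≤ u) : quantile F₀ u = ⊤ := by
  simp [quantile, hu, show ¬ u ≤ 0 by linarith]

lemma quantile_of_mem {u : ℝ} (h0 : 0 < u) (h1 : u < 1) :
    quantile F₀ u = ((sInf {x : ℝ | u ≤ cdf F₀ x} : ℝ) : EReal) := by
  simp [quantile, not_le.2 h0, not_le.2 h1]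

lemma quantile_mono : Monotone (quantile F₀) := by
  intro u v huv
  rcases le_or_gt u 0 with hu | hu
  · simp [quantile_of_nonpos F₀ hu]
  rcases le_or_gt 1 v with hv | hv
  · simp [quantile_of_one_le F₀ hv]
  rw [quantile_of_mem F₀ hu (by linarith), quantile_of_mem F₀ (by linarith) hv,
    EReal.coe_le_coe_iff]
  exact csInf_le_csInf (bddBelow_le_cdf F₀ hu) (exists_le_cdf F₀ hv)
    fun x (hx : v ≤ _) => huv.trans hx

lemma measurableSet_cell (m j : ℕ) : MeasurableSet (cell F₀ m j) :=
  (measurableSet_lt measurable_const measurable_coe_real_ereal).inter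
    (measurableSet_le measurable_coe_real_ereal measurable_const)

lemma exists_mem_cell (m : ℕ) (x : ℝ) : ∃ j, 1 ≤ j ∧ j ≤ 2 ^ m ∧ x ∈ cell F₀ m j := by
  classical
  -- The index sought is the least such `j`; minimality gives the strict lower bound.
  have hex : ∃ j : ℕ, (x : EReal) ≤ quantile F₀ ((j : ℝ) / 2 ^ m) :=
    ⟨2 ^ m, by rw [quantile_of_one_le F₀ (by simp)]; exact le_top⟩
  have hpos : Nat.find hex ≠ 0 := by
    intro h
    have := Nat.find_spec hex
    rw [h, quantile_of_nonpos F₀ (by simp)] at this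
    simp at this
  obtain ⟨k, hk⟩ := Nat.exists_eq_succ_of_ne_zero hpos
  refine ⟨Nat.find hex, by omega,
    Nat.find_min' hex (by rw [quantile_of_one_le F₀ (by simp)]; exact le_top), ?_,
    Nat.find_spec hex⟩
  have := Nat.find_min hex (m := k) (by omega)
  rw [hk]
  simpa using this

lemma cell_unique {m j k : ℕ} {x : ℝ} (hj : x ∈ cell F₀ m j) (hk : x ∈ cell F₀ m k) : j = k := by
  by_contra hne
  wlog h : j < k generalizing j k
  · exact this hk hj (Ne.symm hne) (by omega)
  have h1 : ((j : ℝ)) / 2 ^ m ≤ ((k : ℝ) - 1) / 2 ^ m := by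
    have : (j : ℝ) + 1 ≤ k := by exact_mod_cast h
    gcongr
    linarith
  exact absurd (hj.2.trans (quantile_mono F₀ h1)) (not_le.2 hk.1)

lemma cellIndex_spec (m : ℕ) (x : ℝ) :
    1 ≤ cellIndex F₀ m x ∧ cellIndex F₀ m x ≤ 2 ^ m ∧ x ∈ cell F₀ m (cellIndex F₀ m x) :=
  Nat.sInf_mem (exists_mem_cell F₀ m x)

lemma cellIndex_eq_iff {m j : ℕ} {x : ℝ} :
    cellIndex F₀ m x = j ↔ x ∈ cell F₀ m j :=
  ⟨fun h => h ▸ (cellIndex_spec F₀ m x).2.2,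
    fun h => cell_unique F₀ (cellIndex_spec F₀ m x).2.2 h⟩

/-- Dyadic intervals nest, and monotonicity of the quantile function carries this over to the cells.
-/
lemma cell_succ_subset (m j : ℕ) : cell F₀ (m + 1) j ⊆ cell F₀ m ((j + 1) / 2) := by
  rintro x ⟨h1, h2⟩
  have hd : 2 * (((j + 1) / 2 : ℕ) : ℝ) ≤ j + 1 ∧ (j : ℝ) ≤ 2 * (((j + 1) / 2 : ℕ) : ℝ) := by
    constructor
    · exact_mod_cast (by omega : 2 * ((j + 1) / 2) ≤ j + 1)
    · exact_mod_cast (by omega : j ≤ 2 * ((j + 1) / 2))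
  refine ⟨lt_of_le_of_lt (quantile_mono F₀ ?_) h1, h2.trans (quantile_mono F₀ ?_)⟩
  · rw [div_le_div_iff₀ (by positivity) (by positivity), pow_succ]
    nlinarith [pow_pos (two_pos : (0 : ℝ) < 2) m]
  · rw [div_le_div_iff₀ (by positivity) (by positivity), pow_succ]
    nlinarith [pow_pos (two_pos : (0 : ℝ) < 2) m]

lemma cellIndex_succ (m : ℕ) (x : ℝ) :
    (cellIndex F₀ (m + 1) x + 1) / 2 = cellIndex F₀ m x :=
  cell_unique F₀ (cell_succ_subset F₀ m _ (cellIndex_spec F₀ (m + 1) x).2.2)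
    (cellIndex_spec F₀ m x).2.2

lemma ancestor_cellIndex {m M : ℕ} (h : m ≤ M) (x : ℝ) :
    ancestor M (cellIndex F₀ M x) m = cellIndex F₀ m x := by
  induction M, h using Nat.le_induction with
  | base => exact ancestor_self _ _
  | succ M hM ih => rw [ancestor_succ hM, cellIndex_succ, ih]

lemma measurable_cellIndex (m : ℕ) : Measurable (cellIndex F₀ m) := by
  refine measurable_to_countable' fun j => ?_
  convert measurableSet_cell F₀ m j using 1
  ext x
  exact cellIndex_eq_iff F₀

variable [IsProbabilityMeasure F₀] [NullSingletonClass F₀]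

/-- Left continuity, from the absence of atoms, gives `≤`; right continuity gives `≥`. -/
lemma cdf_sInf {u : ℝ} (h0 : 0 < u) (h1 : u < 1) :
    cdf F₀ (sInf {x : ℝ | u ≤ cdf F₀ x}) = u := by
  set q := sInf {x : ℝ | u ≤ cdf F₀ x} with hq
  have hb := bddBelow_le_cdf F₀ h0
  have hne := exists_le_cdf F₀ h1
  refine le_antisymm ?_ ?_
  · have hlt : ∀ y < q, cdf F₀ y ≤ u := fun y hy => by
      by_contra h
      exact absurd (csInf_le hb (show y ∈ {x : ℝ | u ≤ cdf F₀ x} from (not_le.1 h).le))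
        (not_le.2 hy)
    have hc : Tendsto (cdf F₀) (𝓝[<] q) (𝓝 (cdf F₀ q)) := by
      have := (cdf F₀).measure_singleton q
      rw [measure_cdf, measure_singleton, eq_comm, ENNReal.ofReal_eq_zero] at this
      have h2 := (cdf F₀).mono.tendsto_leftLim q
      have h3 := (cdf F₀).mono.leftLim_le (le_refl q)
      rwa [show Function.leftLim (cdf F₀) q = cdf F₀ q by linarith] at h2
    exact le_of_tendsto hc (eventually_mem_nhdsWithin.mono hlt)
  · have hr : Tendsto (cdf F₀) (𝓝[>] q) (𝓝 (cdf F₀ q)) :=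
      ((cdf F₀).right_continuous q).mono_left (nhdsWithin_mono _ Ioi_subset_Ici_self)
    refine ge_of_tendsto hr (eventually_mem_nhdsWithin.mono fun y hy => ?_)
    obtain ⟨z, hz, hzy⟩ := exists_lt_of_csInf_lt hne hy
    exact le_trans hz (monotone_cdf F₀ hzy.le)

lemma measure_le_quantile {u : ℝ} (h0 : 0 ≤ u) (h1 : u ≤ 1) :
    F₀.real {x : ℝ | (x : EReal) ≤ quantile F₀ u} = u := by
  rcases h0.eq_or_lt with rfl | h0
  · simp [quantile_of_nonpos]
  rcases h1.eq_or_lt with rfl | h1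
  · simp [quantile_of_one_le]
  rw [quantile_of_mem F₀ h0 h1]
  simp_rw [EReal.coe_le_coe_iff]
  exact (cdf_eq_real F₀ _).symm.trans (cdf_sInf F₀ h0 h1)

lemma measure_cell {m j : ℕ} (hj : 1 ≤ j) (hj' : j ≤ 2 ^ m) :
    F₀.real (cell F₀ m j) = 1 / 2 ^ m := by
  have hj1 : (1 : ℝ) ≤ j := by exact_mod_cast hj
  have hj2 : (j : ℝ) ≤ 2 ^ m := by exact_mod_cast hj'
  have hp : (0 : ℝ) < 2 ^ m := by positivity
  have e : cell F₀ m j = {x : ℝ | (x : EReal) ≤ quantile F₀ ((j : ℝ) / 2 ^ m)} \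
      {x : ℝ | (x : EReal) ≤ quantile F₀ (((j : ℝ) - 1) / 2 ^ m)} := by
    ext x
    simp [cell, and_comm]
  have hle : ((j : ℝ) - 1) / 2 ^ m ≤ (j : ℝ) / 2 ^ m := by gcongr; linarith
  rw [e, measureReal_sdiff (ofPred_subset_ofPred.2 fun x hx => hx.trans (quantile_mono F₀ hle))
    (measurableSet_le measurable_coe_real_ereal measurable_const),
    measure_le_quantile F₀ (by positivity) (by rw [div_le_one hp]; exact hj2),
    measure_le_quantile F₀ (div_nonneg (by linarith) hp.le) (by rw [div_le_one hp]; linarith)]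
  field_simp
  ring

lemma integral_comp_cellIndex (M : ℕ) (g : ℕ → ℝ) :
    Integrable (fun x => g (cellIndex F₀ M x)) F₀ ∧
    ∫ x, g (cellIndex F₀ M x) ∂F₀ = (∑ i ∈ Finset.range (2 ^ M), g (i + 1)) / 2 ^ M := by
  have e : (fun x => g (cellIndex F₀ M x))
      = fun x => ∑ j ∈ Finset.Icc 1 (2 ^ M), (cell F₀ M j).indicator (fun _ => g j) x := by
    ext x
    obtain ⟨h1, h2, h3⟩ := cellIndex_spec F₀ M x
    rw [Finset.sum_eq_single_of_mem (cellIndex F₀ M x) (Finset.mem_Icc.2 ⟨h1, h2⟩),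
      indicator_of_mem h3]
    intro j _ hne
    exact indicator_of_notMem (fun h => hne (cell_unique F₀ h h3)) _
  have hi : ∀ j, Integrable ((cell F₀ M j).indicator (fun _ => g j)) F₀ := fun j =>
    (integrable_const _).indicator (measurableSet_cell F₀ M j)
  rw [e]
  refine ⟨integrable_finsetSum _ fun j _ => hi j, ?_⟩
  rw [integral_finsetSum _ fun j _ => hi j, Finset.sum_div,
    ← sum_Icc_one_eq_sum_range _ (fun j => g j / 2 ^ M)]
  refine Finset.sum_congr rfl fun j hj => ?_
  obtain ⟨h1, h2⟩ := Finset.mem_Icc.1 hj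
  rw [integral_indicator_const _ (measurableSet_cell F₀ M j), measure_cell F₀ h1 h2, smul_eq_mul]
  ring

end Cells

/-! ### The Kullback-Leibler divergence of a tree density -/

/-- The cells containing `x` at coarser levels are the ancestors of its level-`M` cell, so the
product follows a single path. -/
lemma treeDensity_eq (M : ℕ) (F₀ : Measure ℝ) (f₀ : ℝ → ℝ) (y : ℕ → ℕ → ℝ) (x : ℝ) :
    treeDensity M F₀ f₀ y x = pathProd y M (cellIndex F₀ M x - 1) * 2 ^ M * f₀ x := by
  rw [treeDensity, pathProd, Nat.sub_add_cancel (cellIndex_spec F₀ M x).1]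
  congr 2
  exact Finset.prod_congr rfl fun m hm => by
    rw [ancestor_cellIndex F₀ (Finset.mem_Icc.1 hm).2]

lemma klIntegrand_treeDensity (M : ℕ) (F₀ : Measure ℝ) (f₀ : ℝ → ℝ) (y : ℕ → ℕ → ℝ) (x : ℝ) :
    klIntegrand (treeDensity M F₀ f₀ y) f₀ x
      = f₀ x * -Real.negMulLog (pathProd y M (cellIndex F₀ M x - 1) * 2 ^ M) := by
  rw [klIntegrand, treeDensity_eq, Real.negMulLog]
  -- Where `f₀` vanishes so does the tree density, and the junk value of the quotient is multiplied
  -- by 0.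
  rcases eq_or_ne (f₀ x) 0 with h | h
  · simp [h]
  · rw [mul_div_cancel_right₀ _ h]
    ring

lemma measurable_treeDensity (M : ℕ) (F₀ : Measure ℝ) {f₀ : ℝ → ℝ} (hf₀ : Measurable f₀)
    (y : ℕ → ℕ → ℝ) : Measurable (treeDensity M F₀ f₀ y) := by
  have : treeDensity M F₀ f₀ y = fun x =>
      pathProd y M (cellIndex F₀ M x - 1) * 2 ^ M * f₀ x := funext (treeDensity_eq M F₀ f₀ y)
  rw [this]
  have h1 : Measurable fun x => pathProd y M (cellIndex F₀ M x - 1) :=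
    (measurable_from_nat (f := fun j => pathProd y M (j - 1))).comp (measurable_cellIndex F₀ M)
  fun_prop

lemma treeDensity_nonneg {M : ℕ} {F₀ : Measure ℝ} {f₀ : ℝ → ℝ} (hf₀ : ∀ x, 0 ≤ f₀ x)
    {y : ℕ → ℕ → ℝ} (hy : ∀ m < M, ∀ j < 2 ^ (m + 1), 0 ≤ y (m + 1) (j + 1)) (x : ℝ) :
    0 ≤ treeDensity M F₀ f₀ y x := by
  rw [treeDensity_eq]
  have h := cellIndex_spec F₀ M x
  exact mul_nonneg (mul_nonneg (pathProd_nonneg hy _ (by omega)) (by positivity)) (hf₀ x)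

lemma kl_treeDensity {M : ℕ} {F₀ : Measure ℝ} [IsProbabilityMeasure F₀] {f₀ : ℝ → ℝ}
    (hf₀ : IsDensity f₀ F₀) {y : ℕ → ℕ → ℝ} (hy : IsBranching M y) :
    Integrable (klIntegrand (treeDensity M F₀ f₀ y) f₀) ∧
      kl (treeDensity M F₀ f₀ y) f₀ = reverseKLSum M y := by
  have hna : NullSingletonClass F₀ := by rw [hf₀.eq_withDensity]; infer_instance
  obtain ⟨h1, h2⟩ := integral_comp_cellIndex F₀ M
    (fun j => -Real.negMulLog (pathProd y M (j - 1) * 2 ^ M))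
  have hm : Measurable fun x => ENNReal.ofReal (f₀ x) := hf₀.measurable.ennreal_ofReal
  have ht : ∀ᵐ x, ENNReal.ofReal (f₀ x) < ⊤ := Eventually.of_forall fun x => by simp
  have e : klIntegrand (treeDensity M F₀ f₀ y) f₀ = fun x => (ENNReal.ofReal (f₀ x)).toReal •
      -Real.negMulLog (pathProd y M (cellIndex F₀ M x - 1) * 2 ^ M) := by
    ext x
    rw [klIntegrand_treeDensity, ENNReal.toReal_ofReal (hf₀.nonneg x), smul_eq_mul]
  constructor
  · rw [e, ← integrable_withDensity_iff_integrable_smul' hm ht, ← hf₀.eq_withDensity]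
    exact h1
  · rw [kl, e, ← integral_withDensity_eq_integral_toReal_smul hm ht, ← hf₀.eq_withDensity, h2,
      reverseKLSum_eq hy, ← sum_negMulLog_pathProd hy]
    simp only [Nat.add_sub_cancel, Real.negMulLog_mul, Finset.sum_neg_distrib,
      Finset.sum_add_distrib, ← Finset.mul_sum, ← Finset.sum_mul, sum_pathProd hy]
    rw [Real.negMulLog, Real.log_pow]
    field_simp
    ring

lemma kl_of_isDensity {M : ℕ} {F₀ : Measure ℝ} [IsProbabilityMeasure F₀] {f₀ : ℝ → ℝ}
    (hf₀ : IsDensity f₀ F₀) {y : ℕ → ℕ → ℝ} (hy : IsBranching M y)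
    (hy0 : ∀ m < M, ∀ j < 2 ^ (m + 1), 0 ≤ y (m + 1) (j + 1)) {F : Measure ℝ} {f : ℝ → ℝ}
    [IsProbabilityMeasure F]
    (hF : F = volume.withDensity (fun x => ENNReal.ofReal (treeDensity M F₀ f₀ y x)))
    (hf : IsDensity f F) :
    Integrable (klIntegrand f f₀) ∧ kl f f₀ = reverseKLSum M y := by
  -- Densities of one measure agree almost everywhere; nonnegativity is needed because
  -- `ENNReal.ofReal` forgets negative values.
  have h : f =ᵐ[volume] treeDensity M F₀ f₀ y := by
    have h1 := hf.eq_withDensity.symm.trans hF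
    rw [withDensity_eq_iff_of_sigmaFinite hf.measurable.ennreal_ofReal.aemeasurable
      (measurable_treeDensity M F₀ hf₀.measurable y).ennreal_ofReal.aemeasurable] at h1
    filter_upwards [h1] with x hx
    rwa [ENNReal.ofReal_eq_ofReal_iff (hf.nonneg x)
      (treeDensity_nonneg hf₀.nonneg hy0 x)] at hx
  have h2 : klIntegrand f f₀ =ᵐ[volume] klIntegrand (treeDensity M F₀ f₀ y) f₀ := by
    filter_upwards [h] with x hx
    rw [klIntegrand, klIntegrand, hx]
  obtain ⟨h3, h4⟩ := kl_treeDensity hf₀ hy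
  exact ⟨h3.congr h2.symm, (integral_congr_ae h2).trans h4⟩

open scoped ENNReal

/-! ### The closed form of the variance -/

lemma ratioProd_zero (α : ℝ) (ρ : ℕ → ℝ) : ratioProd α ρ 0 = 1 := by simp [ratioProd]

lemma ratioProd_succ (α : ℝ) (ρ : ℕ → ℝ) (m : ℕ) : ratioProd α ρ (m + 1)
    = ratioProd α ρ m * ((α * ρ (m + 1) + 1) / (2 * α * ρ (m + 1) + 1)) := by
  rw [ratioProd, Finset.prod_Icc_succ_top (by omega), ratioProd]

/-- Twice the identity `E[Y² log Y] + E[Y(1 - Y) log Y] = E[Y log Y]` for a symmetric Beta variable,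
checked here through the digamma recurrence. -/
lemma lambda_relation {α : ℝ} {ρ : ℕ → ℝ} {m : ℕ} (h : 0 < α * ρ m) :
    (α * ρ m + 1) / (2 * α * ρ m + 1) * lambda3 α ρ m
      + α * ρ m / (2 * α * ρ m + 1) * lambda4 α ρ m = lambda2 α ρ m := by
  have h2 : 0 < 2 * α * ρ m + 1 := by linarith
  rw [lambda2, lambda3, lambda4, show α * ρ m + 2 = α * ρ m + 1 + 1 by ring,
    show 2 * α * ρ m + 2 = 2 * α * ρ m + 1 + 1 by ring, digamma_add_one (by linarith),
    digamma_add_one h2]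
  field_simp
  ring

/-- Both parts telescope, since `a / (2a + 1) = 1 - (a + 1) / (2a + 1)` and `2⁻ʲ = 2⁻⁽ʲ⁻¹⁾ - 2⁻ʲ`.
-/
lemma sum_ratioProd_sub_half_pow {α : ℝ} {ρ : ℕ → ℝ} {n : ℕ}
    (h : ∀ m, 1 ≤ m → m ≤ n → 0 < α * ρ m) :
    ∑ j ∈ Finset.Icc 1 n, (α * ρ j / (2 * α * ρ j + 1) * ratioProd α ρ (j - 1) - (1 / 2 : ℝ) ^ j)
      = (1 / 2 : ℝ) ^ n - ratioProd α ρ n := by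
  induction n with
  | zero => simp [ratioProd_zero]
  | succ n ih =>
    have h2 : 2 * α * ρ (n + 1) + 1 ≠ 0 := by linarith [h (n + 1) (by omega) le_rfl]
    rw [Finset.sum_Icc_succ_top (by omega), ih fun m h1 h2 => h m h1 (by omega), ratioProd_succ,
      Nat.add_sub_cancel, pow_succ]
    field_simp
    ring

lemma varA_add_varB {α : ℝ} {ρ : ℕ → ℝ} {M : ℕ} (h : ∀ m, 1 ≤ m → m ≤ M → 0 < α * ρ m) :
    varA α ρ M + varB α ρ M = ∑ m ∈ Finset.range M, ratioProd α ρ m *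
      ((α * ρ (m + 1) + 1) / (2 * α * ρ (m + 1) + 1) * lambda5 α ρ (m + 1)
        + α * ρ (m + 1) / (2 * α * ρ (m + 1) + 1) * lambda6 α ρ (m + 1)
        - lambda2 α ρ (m + 1) ^ 2) := by
  rw [varA, varB, ← Finset.sum_add_distrib, sum_Icc_one_eq_sum_range]
  refine Finset.sum_congr rfl fun m hm => ?_
  have hm := Finset.mem_range.1 hm
  have hcross : ∑ j ∈ Finset.Icc (m + 1 + 1) M,
      ((α * ρ (m + 1) + 1) / (2 * α * ρ (m + 1) + 1) * lambda3 α ρ (m + 1) * lambda2 α ρ j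
        + α * ρ (m + 1) / (2 * α * ρ (m + 1) + 1) * lambda4 α ρ (m + 1) * lambda2 α ρ j
        - lambda2 α ρ (m + 1) * lambda2 α ρ j) = 0 := by
    refine Finset.sum_eq_zero fun j _ => ?_
    rw [← lambda_relation (h (m + 1) (by omega) hm)]
    ring
  simp only [Nat.add_sub_cancel, hcross, ← sub_mul, ← Finset.sum_mul]
  rw [sum_ratioProd_sub_half_pow fun k h1 h2 => h k h1 (by omega), ratioProd_succ, pow_succ]
  ring

/-! ### The filtration of a finite Pólya tree -/

namespace IsFinitePolyaTree

variable {Ω : Type*} {M : ℕ} {Y : ℕ → ℕ → Ω → ℝ}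

/-- The σ-algebra generated by the left branching probabilities whose level satisfies `s`. -/
@[reducible] def levels (M : ℕ) (Y : ℕ → ℕ → Ω → ℝ) (s : Set ℕ) : MeasurableSpace Ω :=
  ⨆ p ∈ {p : (Σ m : Fin M, Fin (2 ^ (m : ℕ))) | (p.1 : ℕ) ∈ s},
    MeasurableSpace.comap (Y ((p.1 : ℕ) + 1) (2 * (p.2 : ℕ) + 1)) inferInstance

lemma levels_mono {s t : Set ℕ} (h : s ⊆ t) : levels M Y s ≤ levels M Y t :=
  biSup_mono fun _ hp => h hp

lemma measurable_levels_left {s : Set ℕ} {m i : ℕ} (hm : m < M) (hi : i < 2 ^ m) (hs : m ∈ s) :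
    Measurable[levels M Y s] (Y (m + 1) (2 * i + 1)) := by
  have h : MeasurableSpace.comap (Y (m + 1) (2 * i + 1)) inferInstance ≤ levels M Y s :=
    le_iSup₂_of_le (f := fun (p : (Σ m : Fin M, Fin (2 ^ (m : ℕ))))
      (_ : p ∈ {p : (Σ m : Fin M, Fin (2 ^ (m : ℕ))) | (p.1 : ℕ) ∈ s}) =>
      MeasurableSpace.comap (Y ((p.1 : ℕ) + 1) (2 * (p.2 : ℕ) + 1)) inferInstance)
      ⟨⟨m, hm⟩, ⟨i, hi⟩⟩ hs le_rfl
  exact (comap_measurable _).mono h le_rfl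

variable [mΩ : MeasurableSpace Ω] {P : Measure Ω} {α : ℝ} {ρ : ℕ → ℝ} {F₀ : Measure ℝ}
  {f₀ : ℝ → ℝ} {F : Ω → Measure ℝ}

lemma levels_le (hF : IsFinitePolyaTree P M α ρ F₀ f₀ Y F)
    (s : Set ℕ) : levels M Y s ≤ mΩ :=
  iSup₂_le fun p _ => (hF.measurable_left p).comap_le

lemma isBranching (hF : IsFinitePolyaTree P M α ρ F₀ f₀ Y F)
    (ω : Ω) : IsBranching M (fun m j => Y m j ω) := fun m hm i hi =>
  hF.right ⟨⟨m, hm⟩, ⟨i, hi⟩⟩ ω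

lemma right_eq (hF : IsFinitePolyaTree P M α ρ F₀ f₀ Y F)
    {m i : ℕ} (hm : m < M) (hi : i < 2 ^ m) :
    Y (m + 1) (2 * i + 2) = fun ω => 1 - Y (m + 1) (2 * i + 1) ω :=
  funext fun ω => hF.isBranching ω m hm i hi

lemma measurable_left' (hF : IsFinitePolyaTree P M α ρ F₀ f₀ Y F)
    {m i : ℕ} (hm : m < M) (hi : i < 2 ^ m) :
    Measurable (Y (m + 1) (2 * i + 1)) := hF.measurable_left ⟨⟨m, hm⟩, ⟨i, hi⟩⟩

lemma map_left (hF : IsFinitePolyaTree P M α ρ F₀ f₀ Y F)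
    {m i : ℕ} (hm : m < M) (hi : i < 2 ^ m) :
    P.map (Y (m + 1) (2 * i + 1)) = betaMeasure (α * ρ (m + 1)) (α * ρ (m + 1)) :=
  hF.law ⟨⟨m, hm⟩, ⟨i, hi⟩⟩

lemma integral_comp_left (hF : IsFinitePolyaTree P M α ρ F₀ f₀ Y F)
    {m i : ℕ} (hm : m < M) (hi : i < 2 ^ m) {g : ℝ → ℝ}
    (hg : Measurable g) : ∫ ω, g (Y (m + 1) (2 * i + 1) ω) ∂P
      = ∫ x, g x ∂(betaMeasure (α * ρ (m + 1)) (α * ρ (m + 1))) := by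
  rw [← hF.map_left hm hi, integral_map (hF.measurable_left' hm hi).aemeasurable
    hg.aestronglyMeasurable]

lemma ae_left_mem (hF : IsFinitePolyaTree P M α ρ F₀ f₀ Y F)
    {m i : ℕ} (hm : m < M) (hi : i < 2 ^ m) :
    ∀ᵐ ω ∂P, Y (m + 1) (2 * i + 1) ω ∈ Ioo (0 : ℝ) 1 := by
  have h := betaMeasure_compl_Ioo (α * ρ (m + 1)) (α * ρ (m + 1))
  rw [← hF.map_left hm hi] at h
  exact ae_of_ae_map (hF.measurable_left' hm hi).aemeasurable h

lemma ae_nonneg (hF : IsFinitePolyaTree P M α ρ F₀ f₀ Y F)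
    : ∀ᵐ ω ∂P, ∀ m < M, ∀ j < 2 ^ (m + 1), 0 ≤ Y (m + 1) (j + 1) ω := by
  have h : ∀ᵐ ω ∂P, ∀ p : (Σ m : Fin M, Fin (2 ^ (m : ℕ))),
      Y ((p.1 : ℕ) + 1) (2 * (p.2 : ℕ) + 1) ω ∈ Ioo (0 : ℝ) 1 :=
    ae_all_iff.2 fun p => hF.ae_left_mem p.1.2 p.2.2
  filter_upwards [h] with ω hω m hm j hj
  rw [pow_succ] at hj
  have hi : j / 2 < 2 ^ m := by omega
  have h1 := hω ⟨⟨m, hm⟩, ⟨j / 2, hi⟩⟩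
  have h2 := hF.right ⟨⟨m, hm⟩, ⟨j / 2, hi⟩⟩ ω
  simp only at h1 h2
  rcases Nat.even_or_odd' j with ⟨k, rfl | rfl⟩
  · rw [show 2 * k / 2 = k by omega] at h1
    exact h1.1.le
  · rw [show (2 * k + 1) / 2 = k by omega] at h1 h2
    rw [show 2 * k + 1 + 1 = 2 * k + 2 by ring, h2]
    linarith [h1.2]

lemma memLp_top_comp_left (hF : IsFinitePolyaTree P M α ρ F₀ f₀ Y F)
    {m i : ℕ} (hm : m < M) (hi : i < 2 ^ m) {g : ℝ → ℝ}
    (hg : Continuous g) : MemLp (fun ω => g (Y (m + 1) (2 * i + 1) ω)) ∞ P := by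
  obtain ⟨C, hC⟩ := isCompact_Icc.exists_bound_of_continuousOn (s := Icc (0 : ℝ) 1) hg.continuousOn
  refine memLp_top_of_bound
    (hg.measurable.comp (hF.measurable_left' hm hi)).aestronglyMeasurable C ?_
  filter_upwards [hF.ae_left_mem hm hi] with ω hω
  exact hC _ (Ioo_subset_Icc_self hω)

/-- A level-`n` mass uses only the splits at tree levels `1, …, n`. The σ-algebras are indexed by
the parent's level, whence `Iio n`; the splits below level `n` belong to `{n}` and are independent
of it. -/
lemma pathProd_measurable_and_memLp (hF : IsFinitePolyaTree P M α ρ F₀ f₀ Y F)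
    [IsFiniteMeasure P] {n : ℕ} (hn : n ≤ M) :
    ∀ i < 2 ^ n, Measurable[levels M Y (Iio n)] (fun ω => pathProd (fun m j => Y m j ω) n i) ∧
      MemLp (fun ω => pathProd (fun m j => Y m j ω) n i) ∞ P := by
  induction n with
  | zero =>
    intro i _
    simp only [pathProd_zero]
    exact ⟨measurable_const, memLp_const 1⟩
  | succ n ih =>
    intro i hi
    rw [pow_succ] at hi
    have hk : i / 2 < 2 ^ n := by omega
    obtain ⟨h1, h2⟩ := ih (by omega) _ hk
    have h1' := h1.mono (levels_mono (Iio_subset_Iio n.le_succ)) le_rfl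
    have h3 := measurable_levels_left (Y := Y) (show n < M by omega) hk (mem_Iio.2 n.lt_succ_self)
    simp only [pathProd_succ]
    rcases Nat.even_or_odd' i with ⟨k, rfl | rfl⟩
    · rw [show 2 * k / 2 = k by omega] at *
      exact ⟨h1'.mul h3, (hF.memLp_top_comp_left (by omega) hk continuous_id).mul h2⟩
    · rw [show (2 * k + 1) / 2 = k by omega] at *
      rw [show 2 * k + 1 + 1 = 2 * k + 2 by ring, hF.right_eq (by omega) hk]
      exact ⟨h1'.mul (measurable_const.sub h3),
        (hF.memLp_top_comp_left (by omega) hk (continuous_const.sub continuous_id)).mul h2⟩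

lemma indep_levels (hF : IsFinitePolyaTree P M α ρ F₀ f₀ Y F)
    {s t : Set ℕ} (hst : Disjoint s t) :
    Indep (levels M Y s) (levels M Y t) P := by
  refine indep_iSup_of_disjoint (fun p => (hF.measurable_left p).comap_le)
    ((iIndepFun_iff_iIndep _ _ _).1 hF.indep) ?_
  rw [Set.disjoint_left] at hst ⊢
  exact fun p hp hp' => hst hp hp'

lemma integral_mul_of_levels (hF : IsFinitePolyaTree P M α ρ F₀ f₀ Y F)
    {s t : Set ℕ} (hst : Disjoint s t) {Z W : Ω → ℝ}
    (hZ : Measurable[levels M Y s] Z) (hW : Measurable[levels M Y t] W) :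
    ∫ ω, Z ω * W ω ∂P = (∫ ω, Z ω ∂P) * ∫ ω, W ω ∂P := by
  refine IndepFun.integral_fun_mul_eq_mul_integral ?_
    (hZ.mono (hF.levels_le s) le_rfl).aestronglyMeasurable
    (hW.mono (hF.levels_le t) le_rfl).aestronglyMeasurable
  rw [IndepFun_iff_Indep]
  exact indep_of_indep_of_le_left (indep_of_indep_of_le_right (hF.indep_levels hst) hW.comap_le)
    hZ.comap_le

lemma integral_mul_same_level (hF : IsFinitePolyaTree P M α ρ F₀ f₀ Y F)
    {n i k : ℕ} (hn : n < M) (hi : i < 2 ^ n) (hk : k < 2 ^ n)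
    (hik : i ≠ k) {g : ℝ → ℝ} (hg : Measurable g) :
    ∫ ω, g (Y (n + 1) (2 * i + 1) ω) * g (Y (n + 1) (2 * k + 1) ω) ∂P
      = (∫ ω, g (Y (n + 1) (2 * i + 1) ω) ∂P) * ∫ ω, g (Y (n + 1) (2 * k + 1) ω) ∂P := by
  have h := hF.indep.indepFun (i := ⟨⟨n, hn⟩, ⟨i, hi⟩⟩) (j := ⟨⟨n, hn⟩, ⟨k, hk⟩⟩)
    (by simpa using hik)
  exact (h.comp hg hg).integral_fun_mul_eq_mul_integral
    (hg.comp (hF.measurable_left' hn hi)).aestronglyMeasurable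
    (hg.comp (hF.measurable_left' hn hk)).aestronglyMeasurable

end IsFinitePolyaTree

namespace IsFinitePolyaTree

/-! ### The martingale decomposition of the divergence -/

variable {Ω : Type*} {M : ℕ} {α : ℝ} {ρ : ℕ → ℝ} {Y : ℕ → ℕ → Ω → ℝ}

/-- The binary entropy of the split below the node `i + 1` of level `n`, centred. -/
noncomputable def centredEntropy (α : ℝ) (ρ : ℕ → ℝ) (Y : ℕ → ℕ → Ω → ℝ) (n i : ℕ) (ω : Ω) : ℝ :=
  Real.binEntropy (Y (n + 1) (2 * i + 1) ω) + lambda2 α ρ (n + 1)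

/-- The increment at level `n + 1` of the centred entropy of the tree. -/
noncomputable def increment (α : ℝ) (ρ : ℕ → ℝ) (Y : ℕ → ℕ → Ω → ℝ) (n : ℕ) (ω : Ω) : ℝ :=
  ∑ i ∈ Finset.range (2 ^ n), pathProd (fun m j => Y m j ω) n i * centredEntropy α ρ Y n i ω

/-- The centred entropy of the first `n` levels of the tree. -/
noncomputable def centredSum (α : ℝ) (ρ : ℕ → ℝ) (Y : ℕ → ℕ → Ω → ℝ) (n : ℕ) (ω : Ω) : ℝ :=
  ∑ m ∈ Finset.range n, increment α ρ Y m ω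

lemma centredEntropy_measurable {n i : ℕ} (hn : n < M) (hi : i < 2 ^ n) {s : Set ℕ} (hs : n ∈ s) :
    Measurable[levels M Y s] (centredEntropy α ρ Y n i) :=
  (show Continuous fun x => Real.binEntropy x + lambda2 α ρ (n + 1) by fun_prop).measurable.comp
    (measurable_levels_left hn hi hs)

variable [mΩ : MeasurableSpace Ω] {P : Measure Ω} {F₀ : Measure ℝ} {f₀ : ℝ → ℝ}
  {F : Ω → Measure ℝ}

/-- Since the masses at a level sum to 1, centring every split entropy shifts the level's
contribution by a deterministic amount. -/
lemma reverseKLSum_eq_centredSum (hF : IsFinitePolyaTree P M α ρ F₀ f₀ Y F)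
    (ω : Ω) :
    reverseKLSum M (fun m j => Y m j ω) = (∑ m ∈ Finset.range M, (lambda2 α ρ (m + 1) + Real.log 2))
      - centredSum α ρ Y M ω := by
  have hb := hF.isBranching ω
  have h : ∀ m ∈ Finset.range M, increment α ρ Y m ω
      = ∑ i ∈ Finset.range (2 ^ m), pathProd (fun m j => Y m j ω) m i
          * Real.binEntropy (Y (m + 1) (2 * i + 1) ω) + lambda2 α ρ (m + 1) := by
    intro m hm
    simp only [increment, centredEntropy, mul_add, Finset.sum_add_distrib, ← Finset.sum_mul,
      sum_pathProd (hb.mono (Finset.mem_range.1 hm).le), one_mul]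
  rw [reverseKLSum_eq hb, centredSum, Finset.sum_congr rfl h, Finset.sum_add_distrib,
    Finset.sum_add_distrib]
  simp
  ring

lemma centredEntropy_memLp (hF : IsFinitePolyaTree P M α ρ F₀ f₀ Y F)
    [IsFiniteMeasure P] {n i : ℕ} (hn : n < M) (hi : i < 2 ^ n) :
    MemLp (centredEntropy α ρ Y n i) ∞ P :=
  hF.memLp_top_comp_left hn hi (g := fun x => Real.binEntropy x + lambda2 α ρ (n + 1))
    (by fun_prop)

lemma centredSum_measurable_and_memLp (hF : IsFinitePolyaTree P M α ρ F₀ f₀ Y F)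
    [IsFiniteMeasure P] {n : ℕ} (hn : n ≤ M) :
    Measurable[levels M Y (Iio n)] (centredSum α ρ Y n) ∧ MemLp (centredSum α ρ Y n) ∞ P := by
  have h : ∀ m ∈ Finset.range n, ∀ i ∈ Finset.range (2 ^ m),
      Measurable[levels M Y (Iio n)] (fun ω => pathProd (fun m j => Y m j ω) m i
        * centredEntropy α ρ Y m i ω) ∧
      MemLp (fun ω => pathProd (fun m j => Y m j ω) m i * centredEntropy α ρ Y m i ω) ∞ P := by
    intro m hm i hi
    have hm := Finset.mem_range.1 hm
    have hi := Finset.mem_range.1 hi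
    obtain ⟨h1, h2⟩ := hF.pathProd_measurable_and_memLp (show m ≤ M by omega) i hi
    exact ⟨(h1.mono (levels_mono (Iio_subset_Iio hm.le)) le_rfl).mul
      (centredEntropy_measurable (by omega) hi hm),
      (hF.centredEntropy_memLp (by omega) hi).mul h2⟩
  exact ⟨Finset.measurable_fun_sum _ fun m hm => Finset.measurable_fun_sum _ fun i hi =>
      (h m hm i hi).1,
    memLp_finsetSum _ fun m hm => memLp_finsetSum _ fun i hi => (h m hm i hi).2⟩

lemma increment_memLp (hF : IsFinitePolyaTree P M α ρ F₀ f₀ Y F)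
    [IsFiniteMeasure P] {n : ℕ} (hn : n < M) :
    MemLp (increment α ρ Y n) ∞ P :=
  memLp_finsetSum _ fun i hi => (hF.centredEntropy_memLp hn (Finset.mem_range.1 hi)).mul
    (hF.pathProd_measurable_and_memLp hn.le i (Finset.mem_range.1 hi)).2

lemma integral_centredEntropy (hF : IsFinitePolyaTree P M α ρ F₀ f₀ Y F) (hp : ∀ m, 1 ≤ m → m ≤ M → 0 < α * ρ m)
    [IsProbabilityMeasure P] {n i : ℕ} (hn : n < M) (hi : i < 2 ^ n) :
    ∫ ω, centredEntropy α ρ Y n i ω ∂P = 0 := by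
  have ha := hp (n + 1) (by omega) hn
  have h := hF.memLp_top_comp_left hn hi Real.binEntropy_continuous
  simp only [centredEntropy]
  rw [integral_add (h.integrable le_top) (integrable_const _),
    hF.integral_comp_left hn hi Real.binEntropy_continuous.measurable,
    integral_betaMeasure_binEntropy ha, lambda2]
  simp [mul_assoc]

lemma integral_centredEntropy_sq (hF : IsFinitePolyaTree P M α ρ F₀ f₀ Y F) (hp : ∀ m, 1 ≤ m → m ≤ M → 0 < α * ρ m)
    [IsProbabilityMeasure P] {n i : ℕ} (hn : n < M)
    (hi : i < 2 ^ n) :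
    ∫ ω, centredEntropy α ρ Y n i ω * centredEntropy α ρ Y n i ω ∂P
      = (α * ρ (n + 1) + 1) / (2 * α * ρ (n + 1) + 1) * lambda5 α ρ (n + 1)
        + α * ρ (n + 1) / (2 * α * ρ (n + 1) + 1) * lambda6 α ρ (n + 1)
        - lambda2 α ρ (n + 1) ^ 2 := by
  have ha := hp (n + 1) (by omega) hn
  have h := (hF.memLp_top_comp_left hn hi Real.binEntropy_continuous).integrable le_top
  have h2 := (hF.memLp_top_comp_left hn hi
    (Real.binEntropy_continuous.pow 2)).integrable le_top
  have e : ∀ ω, centredEntropy α ρ Y n i ω * centredEntropy α ρ Y n i ω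
      = (Real.binEntropy ^ 2) (Y (n + 1) (2 * i + 1) ω)
        + (2 * lambda2 α ρ (n + 1) * Real.binEntropy (Y (n + 1) (2 * i + 1) ω)
          + lambda2 α ρ (n + 1) ^ 2) := by
    intro ω
    rw [centredEntropy, Pi.pow_apply]
    ring
  simp_rw [e]
  rw [integral_add h2 (by exact (h.const_mul _).add (integrable_const _)),
    integral_add (h.const_mul _) (integrable_const _), integral_const_mul,
    hF.integral_comp_left hn hi Real.binEntropy_continuous.measurable,
    hF.integral_comp_left hn hi (Real.binEntropy_continuous.pow 2).measurable,
    integral_betaMeasure_binEntropy ha]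
  simp only [Pi.pow_apply]
  rw [integral_betaMeasure_binEntropy_sq ha, lambda2, lambda5, lambda6]
  simp only [integral_const, probReal_univ, smul_eq_mul, one_mul, mul_assoc]
  ring

/-- A split multiplies a node's squared mass by `Y² + (1 - Y)²`, which is independent of that mass.
-/
lemma sum_integral_pathProd_sq (hF : IsFinitePolyaTree P M α ρ F₀ f₀ Y F) (hp : ∀ m, 1 ≤ m → m ≤ M → 0 < α * ρ m)
    [IsProbabilityMeasure P] {n : ℕ} (hn : n ≤ M) :
    ∑ i ∈ Finset.range (2 ^ n), ∫ ω, pathProd (fun m j => Y m j ω) n i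
      * pathProd (fun m j => Y m j ω) n i ∂P = ratioProd α ρ n := by
  induction n with
  | zero => simp [pathProd_zero, ratioProd_zero]
  | succ n ih =>
    have ha := hp (n + 1) (by omega) hn
    rw [ratioProd_succ, ← ih (by omega), pow_succ', sum_range_two_mul, Finset.sum_mul]
    refine Finset.sum_congr rfl fun i hi => ?_
    have hi := Finset.mem_range.1 hi
    have hn' : n < M := by omega
    obtain ⟨hV, -⟩ := hF.pathProd_measurable_and_memLp hn'.le i hi
    have hmem := fun k hk => (hF.pathProd_measurable_and_memLp hn k hk).2
    have hk1 : 2 * i < 2 ^ (n + 1) := by rw [pow_succ]; omega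
    have hk2 : 2 * i + 1 < 2 ^ (n + 1) := by rw [pow_succ]; omega
    rw [← integral_add (by exact ((hmem _ hk1).mul (hmem _ hk1) : MemLp _ ∞ P).integrable le_top)
      (by exact ((hmem _ hk2).mul (hmem _ hk2) : MemLp _ ∞ P).integrable le_top)]
    have e : ∀ ω, pathProd (fun m j => Y m j ω) (n + 1) (2 * i)
          * pathProd (fun m j => Y m j ω) (n + 1) (2 * i)
        + pathProd (fun m j => Y m j ω) (n + 1) (2 * i + 1)
          * pathProd (fun m j => Y m j ω) (n + 1) (2 * i + 1)
        = (pathProd (fun m j => Y m j ω) n i * pathProd (fun m j => Y m j ω) n i)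
          * ((Y (n + 1) (2 * i + 1) ω) ^ 2 + (1 - Y (n + 1) (2 * i + 1) ω) ^ 2) := by
      intro ω
      rw [pathProd_succ_left, pathProd_succ_right, hF.right_eq hn' hi]
      ring
    have hg : Measurable fun x : ℝ => x ^ 2 + (1 - x) ^ 2 := by fun_prop
    have h1 := hF.integral_mul_of_levels (s := Iio n) (t := {n}) (by simp) (hV.mul hV)
      (hg.comp (measurable_levels_left (Y := Y) hn' hi rfl))
    simp_rw [e]
    refine h1.trans ?_
    congr 1
    refine (hF.integral_comp_left hn' hi hg).trans ?_
    rw [integral_betaMeasure_sq_add_sq ha, mul_assoc]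

/-- Martingale difference property: `Z` times a level-`n` mass is determined by earlier splits,
hence independent of the centred entropy below that node. -/
lemma integral_mul_increment (hF : IsFinitePolyaTree P M α ρ F₀ f₀ Y F) (hp : ∀ m, 1 ≤ m → m ≤ M → 0 < α * ρ m)
    [IsProbabilityMeasure P] {n : ℕ} (hn : n < M) {Z : Ω → ℝ}
    (hZ : Measurable[levels M Y (Iio n)] Z) (hZ' : MemLp Z ∞ P) :
    ∫ ω, Z ω * increment α ρ Y n ω ∂P = 0 := by
  simp only [increment, Finset.mul_sum, ← mul_assoc]
  have hmem := hF.pathProd_measurable_and_memLp hn.le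
  rw [integral_finsetSum _ fun i hi => ?_]
  · refine Finset.sum_eq_zero fun i hi => ?_
    have hi := Finset.mem_range.1 hi
    refine (hF.integral_mul_of_levels (s := Iio n) (t := {n}) (by simp) (hZ.mul (hmem i hi).1)
      (centredEntropy_measurable hn hi rfl)).trans ?_
    rw [hF.integral_centredEntropy hp hn hi, mul_zero]
  · have hi := Finset.mem_range.1 hi
    exact ((hF.centredEntropy_memLp hn hi).mul
      ((hmem i hi).2.mul hZ' : MemLp _ ∞ P) : MemLp _ ∞ P).integrable le_top

lemma integral_increment_sq (hF : IsFinitePolyaTree P M α ρ F₀ f₀ Y F) (hp : ∀ m, 1 ≤ m → m ≤ M → 0 < α * ρ m)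
    [IsProbabilityMeasure P] {n : ℕ} (hn : n < M) :
    ∫ ω, increment α ρ Y n ω * increment α ρ Y n ω ∂P = ratioProd α ρ n *
      ((α * ρ (n + 1) + 1) / (2 * α * ρ (n + 1) + 1) * lambda5 α ρ (n + 1)
        + α * ρ (n + 1) / (2 * α * ρ (n + 1) + 1) * lambda6 α ρ (n + 1)
        - lambda2 α ρ (n + 1) ^ 2) := by
  have hmem := hF.pathProd_measurable_and_memLp hn.le
  have hc := fun i (hi : i < 2 ^ n) => hF.centredEntropy_memLp hn hi
  have hcm := fun i (hi : i < 2 ^ n) =>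
    centredEntropy_measurable (Y := Y) (α := α) (ρ := ρ) hn hi (mem_singleton n)
  have e : ∀ ω, increment α ρ Y n ω * increment α ρ Y n ω
      = ∑ i ∈ Finset.range (2 ^ n), ∑ k ∈ Finset.range (2 ^ n),
        (pathProd (fun m j => Y m j ω) n i * pathProd (fun m j => Y m j ω) n k)
          * (centredEntropy α ρ Y n i ω * centredEntropy α ρ Y n k ω) := by
    intro ω
    rw [increment, Finset.sum_mul_sum]
    exact Finset.sum_congr rfl fun i _ => Finset.sum_congr rfl fun k _ => by ring
  have hint : ∀ i ∈ Finset.range (2 ^ n), ∀ k ∈ Finset.range (2 ^ n),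
      Integrable (fun ω => (pathProd (fun m j => Y m j ω) n i * pathProd (fun m j => Y m j ω) n k)
          * (centredEntropy α ρ Y n i ω * centredEntropy α ρ Y n k ω)) P := by
    intro i hi k hk
    have hi := Finset.mem_range.1 hi
    have hk := Finset.mem_range.1 hk
    exact (((hc k hk).mul (hc i hi) : MemLp _ ∞ P).mul
      ((hmem k hk).2.mul (hmem i hi).2 : MemLp _ ∞ P) : MemLp _ ∞ P).integrable le_top
  simp_rw [e]
  rw [integral_finsetSum _ fun i hi => integrable_finsetSum _ fun k hk => hint i hi k hk,
    ← hF.sum_integral_pathProd_sq hp hn.le, Finset.sum_mul]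
  refine Finset.sum_congr rfl fun i hi' => ?_
  have hi := Finset.mem_range.1 hi'
  -- Only `k = i` survives: different splits at one level are independent with mean zero, and
  -- jointly independent of the masses.
  rw [integral_finsetSum _ fun k hk => hint i hi' k hk, Finset.sum_eq_single_of_mem i hi']
  · rw [← hF.integral_centredEntropy_sq hp hn hi]
    exact hF.integral_mul_of_levels (s := Iio n) (t := {n}) (by simp)
      ((hmem i hi).1.mul (hmem i hi).1) ((hcm i hi).mul (hcm i hi))
  · intro k hk hne
    have hk := Finset.mem_range.1 hk
    refine (hF.integral_mul_of_levels (s := Iio n) (t := {n}) (by simp)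
      ((hmem i hi).1.mul (hmem k hk).1) ((hcm i hi).mul (hcm k hk))).trans ?_
    have h0 := hF.integral_mul_same_level hn hi hk hne.symm
      (g := fun x => Real.binEntropy x + lambda2 α ρ (n + 1))
      (Continuous.measurable (by fun_prop))
    have h1 := hF.integral_centredEntropy hp hn hi
    simp only [centredEntropy] at h1
    rw [h1, zero_mul] at h0
    exact mul_eq_zero_of_right _ h0

lemma integral_centredSum (hF : IsFinitePolyaTree P M α ρ F₀ f₀ Y F) (hp : ∀ m, 1 ≤ m → m ≤ M → 0 < α * ρ m)
    [IsProbabilityMeasure P] {n : ℕ} (hn : n ≤ M) :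
    ∫ ω, centredSum α ρ Y n ω ∂P = 0 := by
  simp only [centredSum]
  have hlt : ∀ m ∈ Finset.range n, m < M := fun m hm => by
    have := Finset.mem_range.1 hm
    omega
  rw [integral_finsetSum _ fun m hm => (hF.increment_memLp (hlt m hm)).integrable le_top]
  refine Finset.sum_eq_zero fun m hm => ?_
  have := hF.integral_mul_increment hp (hlt m hm) (Z := fun _ => 1) measurable_const
    (memLp_const 1)
  simpa using this

/-- Pythagoras: each new increment is orthogonal to the sum of the earlier ones. -/
lemma integral_centredSum_sq (hF : IsFinitePolyaTree P M α ρ F₀ f₀ Y F) (hp : ∀ m, 1 ≤ m → m ≤ M → 0 < α * ρ m)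
    [IsProbabilityMeasure P] {n : ℕ} (hn : n ≤ M) :
    ∫ ω, centredSum α ρ Y n ω ^ 2 ∂P = ∑ m ∈ Finset.range n, ratioProd α ρ m *
      ((α * ρ (m + 1) + 1) / (2 * α * ρ (m + 1) + 1) * lambda5 α ρ (m + 1)
        + α * ρ (m + 1) / (2 * α * ρ (m + 1) + 1) * lambda6 α ρ (m + 1)
        - lambda2 α ρ (m + 1) ^ 2) := by
  induction n with
  | zero => simp [centredSum]
  | succ n ih =>
    obtain ⟨h1, h2⟩ := hF.centredSum_measurable_and_memLp (show n ≤ M by omega)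
    have h3 := hF.increment_memLp hn
    have e : ∀ ω, centredSum α ρ Y (n + 1) ω ^ 2 = centredSum α ρ Y n ω ^ 2
        + (2 * (centredSum α ρ Y n ω * increment α ρ Y n ω)
          + increment α ρ Y n ω * increment α ρ Y n ω) := by
      intro ω
      rw [centredSum, Finset.sum_range_succ, ← centredSum]
      ring
    have i1 : Integrable (fun ω => centredSum α ρ Y n ω ^ 2) P := by
      simp_rw [pow_two]
      exact (h2.mul h2 : MemLp _ ∞ P).integrable le_top
    have i2 : Integrable (fun ω => 2 * (centredSum α ρ Y n ω * increment α ρ Y n ω)) P :=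
      ((h3.mul h2 : MemLp _ ∞ P).integrable le_top).const_mul 2
    have i3 : Integrable (fun ω => increment α ρ Y n ω * increment α ρ Y n ω) P :=
      (h3.mul h3 : MemLp _ ∞ P).integrable le_top
    simp_rw [e]
    rw [integral_add i1 (by exact i2.add i3), integral_add i2 i3, integral_const_mul,
      hF.integral_mul_increment hp hn h1 h2, ih (by omega),
      hF.integral_increment_sq hp hn, Finset.sum_range_succ]
    ring

end IsFinitePolyaTree

end PolyaKL

/-! ### Assembly: the divergence as its mean minus a centred bounded sum. -/

theorem mainTheorem3 {Ω : Type*} [MeasurableSpace Ω] (P : Measure Ω) [IsProbabilityMeasure P]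
    (M : ℕ) (α : ℝ) (hα : 0 < α) (ρ : ℕ → ℝ) (hρ : ∀ m, 1 ≤ m → m ≤ M → 0 < ρ m)
    (F₀ : Measure ℝ) [IsProbabilityMeasure F₀] (f₀ : ℝ → ℝ) (hf₀ : PolyaKL.IsDensity f₀ F₀)
    (Y : ℕ → ℕ → Ω → ℝ) (F : Ω → Measure ℝ)
    (hF : PolyaKL.IsFinitePolyaTree P M α ρ F₀ f₀ Y F)
    (f : Ω → ℝ → ℝ) (hf : ∀ᵐ ω ∂P, PolyaKL.IsDensity (f ω) (F ω)) :
    (∀ᵐ ω ∂P, Integrable (PolyaKL.klIntegrand (f ω) f₀) volume ∧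
      PolyaKL.kl (f ω) f₀ = PolyaKL.reverseKLSum M (fun m j => Y m j ω)) ∧
    MemLp (fun ω => PolyaKL.kl (f ω) f₀) 2 P ∧
    ∫ ω, PolyaKL.kl (f ω) f₀ ∂P =
      ∑ m ∈ Finset.Icc 1 M, (PolyaKL.digamma (α * ρ m + 1)
        - PolyaKL.digamma (2 * α * ρ m + 1) + Real.log 2) ∧
    variance (fun ω => PolyaKL.kl (f ω) f₀) P = PolyaKL.varA α ρ M + PolyaKL.varB α ρ M := by
  have hp : ∀ m, 1 ≤ m → m ≤ M → 0 < α * ρ m := fun m h1 h2 => mul_pos hα (hρ m h1 h2)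
  have hkl : ∀ᵐ ω ∂P, Integrable (PolyaKL.klIntegrand (f ω) f₀) volume ∧
      PolyaKL.kl (f ω) f₀ = PolyaKL.reverseKLSum M (fun m j => Y m j ω) := by
    filter_upwards [hf, hF.density, hF.ae_nonneg] with ω h1 h2 h3
    have := hF.isProbabilityMeasure ω
    exact PolyaKL.kl_of_isDensity hf₀ (hF.isBranching ω) h3 h2 h1
  set c : ℝ := ∑ m ∈ Finset.range M, (PolyaKL.lambda2 α ρ (m + 1) + Real.log 2) with hc
  set T : Ω → ℝ := PolyaKL.IsFinitePolyaTree.centredSum α ρ Y M with hT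
  -- No measurability of `ω ↦ f ω` is assumed; this almost sure equality transfers every claim to `c
  -- - T`.
  have hae : (fun ω => PolyaKL.kl (f ω) f₀) =ᵐ[P] fun ω => c - T ω :=
    hkl.mono fun ω h => h.2.trans (hF.reverseKLSum_eq_centredSum ω)
  have hTmem : MemLp T ⊤ P := (hF.centredSum_measurable_and_memLp le_rfl).2
  have hmem : MemLp (fun ω => c - T ω) ⊤ P := (memLp_const c).sub hTmem
  have hmean : ∫ ω, (c - T ω) ∂P = c := by
    rw [integral_sub (integrable_const c) (hTmem.integrable le_top),
      hF.integral_centredSum hp le_rfl]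
    simp
  refine ⟨hkl, (memLp_congr_ae hae).2 (hmem.mono_exponent le_top), ?_, ?_⟩
  · rw [integral_congr_ae hae, hmean, hc, PolyaKL.sum_Icc_one_eq_sum_range]
    rfl
  · rw [variance_congr hae, variance_eq_integral hmem.aestronglyMeasurable.aemeasurable, hmean,
      PolyaKL.varA_add_varB hp, ← hF.integral_centredSum_sq hp le_rfl]
    refine integral_congr_ae (Filter.Eventually.of_forall fun ω => ?_)
    simp [hT]
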